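/- Let $n\in\mathbb N$. For a real skew-symmetric $n\times n$ matrix $\theta$, let $\mathbb A^n_\theta$ be the universal C$^*$-algebra generated by unitaries $u_1,\dots,u_n$ with $u_ku_\ell=e^{2\pi i\theta_{k\ell}}u_\ell u_k$, and let $\gamma$ be the gauge action of $\mathbb R^n$ on it, $\gamma_s(u_k)=e^{2\pi i s_k}u_k$. The matrix $\theta$ is *quite irrational* if, for $\lambda\in\mathbb Z^n$, the condition $e^{2\pi i\langle\lambda,\theta\mu\rangle}=1$ for all $\mu\in\mathbb Z^n$ implies $\lambda=0$. Let $\mathcal A$ be a unital C$^*$-algebra and $\alpha$ an action of a finite group $G$ on $\mathcal A$ by $^*$-automorphisms. The action is *free* if the functions $g\mapsto\sum_i x_i\alpha_g(y_i)$ (finite sums, $x_i,y_i\in\mathcal A$) are dense in $C(G,\mathcal A)$. The triple $(\mathcal A,G,\alpha)$, together with an injective unital $^*$-homomorphism $\iota:\mathbb A^n_\theta\to\mathcal A$, is a *covering* of $\mathbb A^n_\theta$ if $\alpha$ is free and $\iota(\mathbb A^n_\theta)$ is the fixed point algebra of $\alpha$. The covering is *connected* if there is a jointly continuous action $\beta$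 of $\mathbb R^n$ on $\mathcal A$ by $^*$-automorphisms which is ergodic (its fixed point algebra is $\mathbb C1$), has a kernel with compact quotient $\mathbb R^n/\ker\beta$, satisfies $\beta_s\circ\iota=\iota\circ\gamma_s$ for all $s$, and commutes with $\alpha$. Two systems $(\mathcal A,G,\alpha)$ and $(\mathcal A',G',\alpha')$ are *equivalent* if there are a $^*$-isomorphism $\Phi:\mathcal A\to\mathcal A'$ and a group isomorphism $\phi:G\to G'$ with $\Phi\circ\alpha_g=\alpha'_{\phi(g)}\circ\Phi$ for all $g\in G$. **Theorem.** Let $\theta$ be quite irrational, and let $(\mathcal A,G,\alpha)$ be as above with $G$ finite. Consider pairs $(M,\theta')$ of an integer $n\times n$ matrix $M$ with $\det M\ne0$ and a real skew-symmetric $n\times n$ matrix $\theta'$ with $M\theta'M^T\in\theta+M_n(\mathbb Z)$. Let $\gamma'$ denote the action of $(M^{-1}\mathbb Z^n)/\mathbb Z^n$ on $\mathbb A^n_{\theta'}$ induced by its gauge action, and let $U_1,\dots,U_n$ be the canonical generators of $\mathbb A^n_{\theta'}$. 1. There is an $\iota$ for which $(\mathcal A,G,\alpha)$ is a connected covering of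 $\mathbb A^n_\theta$ if and only if $(\mathcal A,G,\alpha)$ is equivalent to $(\mathbb A^n_{\theta'},(M^{-1}\mathbb Z^n)/\mathbb Z^n,\gamma')$ for some such pair $(M,\theta')$. 2. If $\iota$ is given and $(\mathcal A,G,\alpha)$ with $\iota$ is a covering of $\mathbb A^n_\theta$, then it is connected if and only if, for some such pair $(M,\theta')$, there is an equivalence $(\Phi,\phi)$ from $(\mathcal A,G,\alpha)$ to $(\mathbb A^n_{\theta'},(M^{-1}\mathbb Z^n)/\mathbb Z^n,\gamma')$ with $\Phi(\iota(u_k))=U_1^{M_{k1}}\cdots U_n^{M_{kn}}$ for $1\le k\le n$. -/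

import Mathlib

open scoped TensorProduct Matrix

noncomputable section

namespace QuantumTorus

/-! ### The quantum torus as a universal C⋆-algebra -/

/-- The phase `exp (2 π i t)`. -/
def phase (t : ℝ) : ℂ := Complex.exp (2 * Real.pi * Complex.I * t)

theorem phase_zero : phase 0 = 1 := by simp [phase]

theorem phase_add (s t : ℝ) : phase (s + t) = phase s * phase t := by
  rw [phase, phase, phase, ← Complex.exp_add]
  push_cast
  ring_nf

theorem phase_int (m : ℤ) : phase m = 1 := by
  rw [phase, Complex.exp_eq_one_iff]
  exact ⟨m, by push_cast; ring⟩

theorem star_phase (t : ℝ) : star (phase t) = phase (-t) := by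
  simp only [phase, Complex.star_def, ← Complex.exp_conj, map_mul, Complex.conj_I,
    Complex.conj_ofReal, map_ofNat]
  push_cast
  ring_nf

/-- A tuple of unitaries with `v k * v l = exp (2 π i θ k l) v l * v k`. -/
def IsTuple {n : ℕ} (θ : Matrix (Fin n) (Fin n) ℝ) {B : Type*} [CStarAlgebra B]
    (v : Fin n → unitary B) : Prop :=
  ∀ k l, (v k : B) * v l = phase (θ k l) • ((v l : B) * v k)

/-- The `⋆`-algebra generated by `n` unitaries without further relations, i.e. the complex group
algebra of the free group. The parameter `θ` is only used to select the norm introduced below. -/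
def Pre {n : ℕ} (_θ : Matrix (Fin n) (Fin n) ℝ) : Type :=
  MonoidAlgebra ℂ (FreeGroup (Fin n))

namespace Pre

variable {n : ℕ} {θ : Matrix (Fin n) (Fin n) ℝ}

instance : Ring (Pre θ) := inferInstanceAs (Ring (MonoidAlgebra ℂ (FreeGroup (Fin n))))

instance : Algebra ℂ (Pre θ) :=
  inferInstanceAs (Algebra ℂ (MonoidAlgebra ℂ (FreeGroup (Fin n))))

/-- The element `c g` of the group algebra. -/
def single (g : FreeGroup (Fin n)) (c : ℂ) : Pre θ := MonoidAlgebra.single g c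

/-- The generators of the group algebra. -/
def gen (k : Fin n) : Pre θ := single (FreeGroup.of k) 1

theorem induction_linear {motive : Pre θ → Prop} (x : Pre θ) (zero : motive 0)
    (add : ∀ x y, motive x → motive y → motive (x + y))
    (hsingle : ∀ g c, motive (single g c)) : motive x :=
  MonoidAlgebra.induction_linear x zero add hsingle

theorem single_mul (g h : FreeGroup (Fin n)) (a b : ℂ) :
    (single g a : Pre θ) * single h b = single (g * h) (a * b) :=
  MonoidAlgebra.single_mul_single ..

theorem smul_single (g : FreeGroup (Fin n)) (a b : ℂ) :
    a • (single g b : Pre θ) = single g (a * b) :=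
  MonoidAlgebra.smul_single ..

theorem single_add (g : FreeGroup (Fin n)) (a b : ℂ) :
    (single g (a + b) : Pre θ) = single g a + single g b :=
  MonoidAlgebra.single_add ..

theorem one_eq : (1 : Pre θ) = single 1 1 := rfl

/-- The involution as an additive map: `c g ↦ conj c g⁻¹`. -/
def starAux : Pre θ →+ Pre θ :=
  (Finsupp.liftAddHom fun g : FreeGroup (Fin n) =>
    { toFun := fun c : ℂ => (single g⁻¹ (starRingEnd ℂ c) : Pre θ)
      map_zero' := by rw [map_zero]; exact MonoidAlgebra.single_zero _
      map_add' := fun a b => by rw [map_add, single_add] }).comp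
  (MonoidAlgebra.coeffAddEquiv (R := ℂ) (M := FreeGroup (Fin n))).toAddMonoidHom

theorem starAux_single (g : FreeGroup (Fin n)) (c : ℂ) :
    starAux (single g c : Pre θ) = single g⁻¹ (starRingEnd ℂ c) :=
  Finsupp.liftAddHom_apply_single _ _ _

instance : StarRing (Pre θ) where
  star := starAux
  star_involutive x := by
    induction x using induction_linear with
    | zero => simp
    | add x y hx hy => simp only [map_add] at *; rw [hx, hy]
    | hsingle g c => simp [starAux_single]
  star_mul x y := by
    induction x using induction_linear with
    | zero => simp
    | add x x' hx hx' => simp only [add_mul, map_add, mul_add] at *; rw [hx, hx']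
    | hsingle g c =>
      induction y using induction_linear with
      | zero => simp
      | add x x' hx hx' => simp only [add_mul, map_add, mul_add] at *; rw [hx, hx']
      | hsingle h d =>
        simp only [starAux_single, single_mul, mul_inv_rev, map_mul]
        rw [mul_comm]
  star_add x y := map_add starAux x y

theorem star_single (g : FreeGroup (Fin n)) (c : ℂ) :
    star (single g c : Pre θ) = single g⁻¹ (starRingEnd ℂ c) :=
  starAux_single g c

instance : StarModule ℂ (Pre θ) where
  star_smul r x := by
    induction x using induction_linear with
    | zero => simp
    | add x y hx hy => simp only [smul_add, star_add, hx, hy]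
    | hsingle g c => simp [smul_single, star_single]

/-- The C⋆-seminorms on the group algebra in which the defining relations
`u k * u l = exp (2 π i θ k l) u l * u k` hold. They are exactly the seminorms
`x ↦ ‖π x‖` obtained from the unitary tuples satisfying these relations in some C⋆-algebra. -/
structure CStarSeminorm (θ : Matrix (Fin n) (Fin n) ℝ) extends Seminorm ℂ (Pre θ) where
  mul_le' : ∀ x y, toFun (x * y) ≤ toFun x * toFun y
  star_mul_self' : ∀ x, toFun (star x * x) = toFun x * toFun x
  rel' : ∀ k l, toFun (gen k * gen l - phase (θ k l) • (gen l * gen k)) = 0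

namespace CStarSeminorm

variable (q : CStarSeminorm θ)

theorem one_le : q.toSeminorm 1 ≤ 1 := by
  have h := q.star_mul_self' 1
  rw [star_one, mul_one] at h
  change q.toSeminorm 1 = q.toSeminorm 1 * q.toSeminorm 1 at h
  nlinarith [apply_nonneg q.toSeminorm 1]

theorem single_le (g : FreeGroup (Fin n)) (c : ℂ) : q.toSeminorm (single g c) ≤ ‖c‖ := by
  have h := q.star_mul_self' (single g 1)
  rw [star_single, single_mul, inv_mul_cancel, map_one, mul_one, ← one_eq] at h
  change q.toSeminorm 1 = q.toSeminorm (single g 1) * q.toSeminorm (single g 1) at h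
  have h1 := q.one_le
  have h2 : q.toSeminorm (single g 1) ≤ 1 := by
    nlinarith [apply_nonneg q.toSeminorm (single g 1)]
  have h3 : (single g c : Pre θ) = c • single g 1 := by rw [smul_single, mul_one]
  rw [h3, map_smul_eq_mul]
  nlinarith [norm_nonneg c]

end CStarSeminorm

instance : Nonempty (CStarSeminorm θ) :=
  ⟨{ (0 : Seminorm ℂ (Pre θ)) with
      mul_le' := fun _ _ => (mul_zero (0 : ℝ)).ge
      star_mul_self' := fun _ => (mul_zero (0 : ℝ)).symm
      rel' := fun _ _ => rfl }⟩

theorem bddAbove (x : Pre θ) :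
    BddAbove (Set.range fun q : CStarSeminorm θ => q.toSeminorm x) := by
  induction x using induction_linear with
  | zero => exact ⟨0, by rintro _ ⟨q, rfl⟩; simp⟩
  | add x y hx hy =>
    obtain ⟨a, ha⟩ := hx
    obtain ⟨b, hb⟩ := hy
    refine ⟨a + b, ?_⟩
    rintro _ ⟨q, rfl⟩
    exact (map_add_le_add q.toSeminorm x y).trans (add_le_add (ha ⟨q, rfl⟩) (hb ⟨q, rfl⟩))
  | hsingle g c => exact ⟨‖c‖, by rintro _ ⟨q, rfl⟩; exact q.single_le g c⟩

/-- The universal C⋆-seminorm: the supremum of all C⋆-seminorms respecting the relations. -/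
def univNorm (x : Pre θ) : ℝ := ⨆ q : CStarSeminorm θ, q.toSeminorm x

theorem le_univNorm (q : CStarSeminorm θ) (x : Pre θ) : q.toSeminorm x ≤ univNorm x :=
  le_ciSup (bddAbove x) q

theorem univNorm_nonneg (x : Pre θ) : 0 ≤ univNorm x :=
  Real.iSup_nonneg fun q => apply_nonneg q.toSeminorm x

theorem univNorm_mul_le (x y : Pre θ) : univNorm (x * y) ≤ univNorm x * univNorm y :=
  ciSup_le fun q => (q.mul_le' x y).trans
    (mul_le_mul (le_univNorm q x) (le_univNorm q y) (apply_nonneg q.toSeminorm y)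
      (univNorm_nonneg x))

/-- The universal C⋆-seminorm as a ring seminorm. -/
def univRingSeminorm (θ : Matrix (Fin n) (Fin n) ℝ) : RingSeminorm (Pre θ) where
  toFun := univNorm
  map_zero' := by simp [univNorm]
  add_le' x y := ciSup_le fun q => (map_add_le_add q.toSeminorm x y).trans
    (add_le_add (le_univNorm q x) (le_univNorm q y))
  neg' x := by simp only [univNorm, map_neg_eq_map]
  mul_le' := univNorm_mul_le

instance : SeminormedRing (Pre θ) := (univRingSeminorm θ).toSeminormedRing

theorem norm_def (x : Pre θ) : ‖x‖ = univNorm x := rfl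

instance : NormedAlgebra ℂ (Pre θ) where
  norm_smul_le r x := ciSup_le fun q => by
    rw [map_smul_eq_mul]
    exact mul_le_mul_of_nonneg_left (le_univNorm q x) (norm_nonneg r)

theorem norm_mul_self_le (x : Pre θ) : ‖x‖ * ‖x‖ ≤ ‖star x * x‖ := by
  have h : ‖x‖ ≤ √‖star x * x‖ := ciSup_le fun q => by
    apply Real.le_sqrt_of_sq_le
    rw [sq]
    exact (q.star_mul_self' x).symm.trans_le (le_univNorm q (star x * x))
  calc ‖x‖ * ‖x‖ ≤ √‖star x * x‖ * √‖star x * x‖ :=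
        mul_self_le_mul_self (norm_nonneg _) h
    _ = ‖star x * x‖ := Real.mul_self_sqrt (norm_nonneg _)

theorem norm_le_norm_star (x : Pre θ) : ‖x‖ ≤ ‖star x‖ := by
  by_contra! h
  have h1 := norm_mul_self_le x
  have h2 := norm_mul_le (star x) x
  nlinarith [norm_nonneg x, norm_nonneg (star x)]

instance : NormedStarGroup (Pre θ) where
  norm_star_le x := by simpa using norm_le_norm_star (star x)

theorem rel (k l : Fin n) :
    ‖(gen k * gen l - phase (θ k l) • (gen l * gen k) : Pre θ)‖ = 0 := by
  refine le_antisymm (ciSup_le fun q => (q.rel' k l).le) (norm_nonneg _)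

end Pre

/-- The quantum torus: the completion (and separation) of the group algebra with respect to the
universal C⋆-seminorm, i.e. the universal C⋆-algebra generated by unitaries `u 1, …, u n` subject
to `u k * u l = exp (2 π i θ k l) u l * u k`. -/
def Torus {n : ℕ} (θ : Matrix (Fin n) (Fin n) ℝ) : Type :=
  UniformSpace.Completion (Pre θ)

namespace Torus

open UniformSpace

variable {n : ℕ} {θ : Matrix (Fin n) (Fin n) ℝ}

instance : NormedRing (Torus θ) := inferInstanceAs (NormedRing (Completion (Pre θ)))

instance : CompleteSpace (Torus θ) := inferInstanceAs (CompleteSpace (Completion (Pre θ)))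

instance : Algebra ℂ (Torus θ) := inferInstanceAs (Algebra ℂ (Completion (Pre θ)))

/-- The canonical map from the group algebra. -/
def mk : Pre θ →ₐ[ℂ] Torus θ where
  toRingHom := Completion.coeRingHom
  commutes' _ := rfl

theorem norm_mk (x : Pre θ) : ‖(mk x : Torus θ)‖ = ‖x‖ := Completion.norm_coe x

theorem induction {p : Torus θ → Prop} (x : Torus θ) (hp : IsClosed {x | p x})
    (ih : ∀ a, p (mk a)) : p x :=
  Completion.induction_on x hp ih

theorem continuous_mk : Continuous (mk : Pre θ → Torus θ) := Completion.continuous_coe _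

instance : NormedAlgebra ℂ (Torus θ) where
  norm_smul_le r x := by
    induction x using induction with
    | hp =>
      simp only [Algebra.smul_def]
      exact isClosed_le (by fun_prop) (by fun_prop)
    | ih a => rw [← map_smul, norm_mk, norm_mk]; exact norm_smul_le r a

/-- The involution of the quantum torus, the continuous extension of that of the group algebra. -/
instance : Star (Torus θ) := ⟨Completion.map (star : Pre θ → Pre θ)⟩

theorem star_mk (x : Pre θ) : star (mk x : Torus θ) = mk (star x) :=
  Completion.map_coe (star_isometry (E := Pre θ)).uniformContinuous x

instance : ContinuousStar (Torus θ) := ⟨Completion.continuous_map⟩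

instance : InvolutiveStar (Torus θ) where
  star_involutive x := by
    induction x using induction with
    | hp => exact isClosed_eq (by fun_prop) (by fun_prop)
    | ih a => rw [star_mk, star_mk, star_star]

instance : StarMul (Torus θ) where
  star_mul x y := by
    induction x using induction with
    | hp => exact isClosed_eq (by fun_prop) (by fun_prop)
    | ih a =>
      induction y using induction with
      | hp => exact isClosed_eq (by fun_prop) (by fun_prop)
      | ih b => rw [← map_mul, star_mk, star_mk, star_mk, star_mul, map_mul]

instance : StarRing (Torus θ) where
  star_add x y := by
    induction x using induction with
    | hp => exact isClosed_eq (by fun_prop) (by fun_prop)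
    | ih a =>
      induction y using induction with
      | hp => exact isClosed_eq (by fun_prop) (by fun_prop)
      | ih b => rw [← map_add, star_mk, star_mk, star_mk, star_add, map_add]

instance : StarModule ℂ (Torus θ) where
  star_smul r x := by
    induction x using induction with
    | hp =>
      exact isClosed_eq (continuous_star.comp (continuous_const_smul r))
        ((continuous_const_smul (star r)).comp continuous_star)
    | ih a => rw [← map_smul, star_mk, star_mk, star_smul, map_smul]

instance : CStarRing (Torus θ) where
  norm_mul_self_le x := by
    induction x using induction with
    | hp => exact isClosed_le (by fun_prop) (by fun_prop)
    | ih a =>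
      rw [star_mk, ← map_mul, norm_mk, norm_mk]
      exact Pre.norm_mul_self_le a

instance : CStarAlgebra (Torus θ) where

/-- The canonical unitary generators. -/
def u (θ : Matrix (Fin n) (Fin n) ℝ) (k : Fin n) : unitary (Torus θ) :=
  ⟨mk (Pre.gen k), by
    rw [Unitary.mem_iff, star_mk, ← map_mul, ← map_mul, Pre.gen, Pre.star_single, Pre.single_mul,
      Pre.single_mul, inv_mul_cancel, mul_inv_cancel, map_one, mul_one, ← Pre.one_eq, map_one]
    exact ⟨rfl, rfl⟩⟩

theorem isTuple_u : IsTuple θ (u θ) := by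
  intro k l
  rw [← sub_eq_zero, ← norm_eq_zero]
  change ‖(mk (Pre.gen k) * mk (Pre.gen l) -
    phase (θ k l) • (mk (Pre.gen l) * mk (Pre.gen k)) : Torus θ)‖ = 0
  rw [← map_mul, ← map_mul, ← map_smul, ← map_sub, norm_mk, Pre.rel]

section UniversalProperty

variable {B : Type*} [CStarAlgebra B]

/-- The representation of the group algebra given by a tuple of unitaries. -/
def preLift (θ : Matrix (Fin n) (Fin n) ℝ) (v : Fin n → unitary B) : Pre θ →ₐ[ℂ] B :=
  MonoidAlgebra.lift ℂ B (FreeGroup (Fin n)) ((unitary B).subtype.comp (FreeGroup.lift v))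

theorem preLift_single (v : Fin n → unitary B) (g : FreeGroup (Fin n)) (c : ℂ) :
    preLift θ v (Pre.single g c) = c • (FreeGroup.lift v g : B) :=
  MonoidAlgebra.lift_single ..

theorem preLift_gen (v : Fin n → unitary B) (k : Fin n) :
    preLift θ v (Pre.gen k) = v k := by
  rw [Pre.gen, preLift_single, FreeGroup.lift_apply_of, one_smul]

theorem preLift_star (v : Fin n → unitary B) (x : Pre θ) :
    preLift θ v (star x) = star (preLift θ v x) := by
  induction x using Pre.induction_linear with
  | zero => simp
  | add x y hx hy => simp only [star_add, map_add, hx, hy]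
  | hsingle g c =>
    rw [Pre.star_single, preLift_single, preLift_single, map_inv, star_smul]
    rfl

/-- The C⋆-seminorm defined by a tuple of unitaries satisfying the relations. -/
def seminormOf (v : Fin n → unitary B) (hv : IsTuple θ v) : Pre.CStarSeminorm θ where
  toSeminorm := (normSeminorm ℂ B).comp (preLift θ v).toLinearMap
  mul_le' x y := by
    change ‖preLift θ v (x * y)‖ ≤ ‖preLift θ v x‖ * ‖preLift θ v y‖
    rw [map_mul]
    exact norm_mul_le _ _
  star_mul_self' x := by
    change ‖preLift θ v (star x * x)‖ = ‖preLift θ v x‖ * ‖preLift θ v x‖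
    rw [map_mul, preLift_star, CStarRing.norm_star_mul_self]
  rel' k l := by
    change ‖preLift θ v (_ - _)‖ = 0
    rw [map_sub, map_smul, map_mul, map_mul, preLift_gen, preLift_gen, hv k l, sub_self, norm_zero]

theorem norm_preLift_le (v : Fin n → unitary B) (hv : IsTuple θ v) (x : Pre θ) :
    ‖preLift θ v x‖ ≤ ‖x‖ :=
  Pre.le_univNorm (seminormOf v hv) x

theorem continuous_preLift (v : Fin n → unitary B) (hv : IsTuple θ v) :
    Continuous (preLift θ v) :=
  AddMonoidHomClass.continuous_of_bound (preLift θ v) 1 fun x => by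
    rw [one_mul]; exact norm_preLift_le v hv x

/-- The universal property: a tuple of unitaries satisfying the relations in a C⋆-algebra
defines a unital `⋆`-homomorphism on the quantum torus. -/
def lift (v : Fin n → unitary B) (hv : IsTuple θ v) : Torus θ →⋆ₐ[ℂ] B where
  toRingHom := Completion.extensionHom (preLift θ v).toRingHom (continuous_preLift v hv)
  commutes' r := by
    change Completion.extensionHom (preLift θ v).toRingHom (continuous_preLift v hv)
      ((algebraMap ℂ (Pre θ) r : Pre θ) : Completion (Pre θ)) = _
    rw [Completion.extensionHom_coe]
    exact (preLift θ v).commutes r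
  map_star' x := by
    have hu : UniformContinuous (preLift θ v) :=
      uniformContinuous_addMonoidHom_of_continuous (continuous_preLift v hv)
    let E : Torus θ → B := Completion.extension (preLift θ v)
    have hc : Continuous E := Completion.continuous_extension
    have hE : ∀ a : Pre θ, E (mk a) = preLift θ v a := fun a => Completion.extension_coe hu a
    change E (star x) = star (E x)
    induction x using induction with
    | hp => exact isClosed_eq (hc.comp continuous_star) (continuous_star.comp hc)
    | ih a => rw [star_mk, hE, hE, preLift_star]

theorem lift_mk (v : Fin n → unitary B) (hv : IsTuple θ v) (x : Pre θ) :
    lift v hv (mk x) = preLift θ v x :=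
  Completion.extensionHom_coe (preLift θ v).toRingHom (continuous_preLift v hv) x

theorem lift_u (v : Fin n → unitary B) (hv : IsTuple θ v) (k : Fin n) :
    lift v hv (u θ k : Torus θ) = v k :=
  (lift_mk v hv _).trans (preLift_gen v k)

/-- `⋆`-homomorphisms on the quantum torus are determined by the generators. -/
theorem hom_ext {f g : Torus θ →⋆ₐ[ℂ] B} (h : ∀ k, f (u θ k : Torus θ) = g (u θ k : Torus θ)) : f = g := by
  have hf : Continuous f := AddMonoidHomClass.continuous_of_bound f 1 fun x => by
    rw [one_mul]; exact NonUnitalStarAlgHom.norm_apply_le f x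
  have hg : Continuous g := AddMonoidHomClass.continuous_of_bound g 1 fun x => by
    rw [one_mul]; exact NonUnitalStarAlgHom.norm_apply_le g x
  have key : ∀ w : FreeGroup (Fin n), f (mk (Pre.single w 1)) = g (mk (Pre.single w 1)) := by
    intro w
    induction w using FreeGroup.induction_on with
    | C1 => rw [← Pre.one_eq, map_one, map_one, map_one]
    | of k => exact h k
    | inv_of k hk =>
      have : (Pre.single (FreeGroup.of k)⁻¹ 1 : Pre θ) = star (Pre.single (FreeGroup.of k) 1) := by
        rw [Pre.star_single, map_one]
      rw [this, ← star_mk, map_star, map_star, hk]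
    | mul x y hx hy =>
      have : (Pre.single (x * y) 1 : Pre θ) = Pre.single x 1 * Pre.single y 1 := by
        rw [Pre.single_mul, mul_one]
      rw [this, map_mul, map_mul, map_mul, hx, hy]
  ext x
  induction x using induction with
  | hp => exact isClosed_eq hf hg
  | ih a =>
    induction a using Pre.induction_linear with
    | zero => simp
    | add x y hx hy => simp only [map_add, hx, hy]
    | hsingle w c =>
      have : (Pre.single w c : Pre θ) = c • Pre.single w 1 := by rw [Pre.smul_single, mul_one]
      rw [this, map_smul, map_smul, map_smul, key]

end UniversalProperty

/-- The unitaries `exp (2 π i s k) u k`. -/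
def gaugeTuple (θ : Matrix (Fin n) (Fin n) ℝ) (s : Fin n → ℝ) (k : Fin n) : unitary (Torus θ) :=
  ⟨phase (s k) • (u θ k : Torus θ), by
    obtain ⟨h1, h2⟩ := Unitary.mem_iff.1 (u θ k).2
    rw [Unitary.mem_iff, star_smul, star_phase, smul_mul_smul_comm, smul_mul_smul_comm, h1, h2,
      ← phase_add, ← phase_add, neg_add_cancel, add_neg_cancel, phase_zero, one_smul]
    exact ⟨rfl, rfl⟩⟩

theorem isTuple_gaugeTuple (s : Fin n → ℝ) : IsTuple θ (gaugeTuple θ s) := by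
  intro k l
  change (phase (s k) • (u θ k : Torus θ)) * (phase (s l) • (u θ l : Torus θ)) =
    phase (θ k l) • ((phase (s l) • (u θ l : Torus θ)) * (phase (s k) • (u θ k : Torus θ)))
  rw [smul_mul_smul_comm, smul_mul_smul_comm, isTuple_u k l, smul_smul, smul_smul]
  congr 1
  ring

/-- The gauge transformation `γ s : u k ↦ exp (2 π i s k) u k` as an endomorphism. -/
def gaugeHom (θ : Matrix (Fin n) (Fin n) ℝ) (s : Fin n → ℝ) : Torus θ →⋆ₐ[ℂ] Torus θ :=
  lift (gaugeTuple θ s) (isTuple_gaugeTuple s)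

theorem gaugeHom_u (s : Fin n → ℝ) (k : Fin n) :
    gaugeHom θ s (u θ k : Torus θ) = phase (s k) • (u θ k : Torus θ) :=
  lift_u _ _ k

theorem gaugeHom_zero : gaugeHom θ 0 = StarAlgHom.id ℂ (Torus θ) :=
  hom_ext fun k => by rw [gaugeHom_u, Pi.zero_apply, phase_zero, one_smul]; rfl

theorem gaugeHom_add (s t : Fin n → ℝ) :
    gaugeHom θ (s + t) = (gaugeHom θ s).comp (gaugeHom θ t) :=
  hom_ext fun k => by
    rw [StarAlgHom.comp_apply, gaugeHom_u, gaugeHom_u, map_smul, gaugeHom_u, smul_smul,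
      Pi.add_apply, phase_add, mul_comm]

/-- The gauge action of `ℝⁿ` on the quantum torus, `γ s (u k) = exp (2 π i s k) u k`. -/
def gauge (θ : Matrix (Fin n) (Fin n) ℝ) :
    Multiplicative (Fin n → ℝ) →* (Torus θ ≃⋆ₐ[ℂ] Torus θ) where
  toFun s := StarAlgEquiv.ofStarAlgHom (gaugeHom θ s.toAdd) (gaugeHom θ (-s.toAdd))
    (by rw [← gaugeHom_add, neg_add_cancel, gaugeHom_zero])
    (by rw [← gaugeHom_add, add_neg_cancel, gaugeHom_zero])
  map_one' := by
    ext x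
    exact DFunLike.congr_fun gaugeHom_zero x
  map_mul' s t := by
    ext x
    exact DFunLike.congr_fun (gaugeHom_add s.toAdd t.toAdd) x

theorem gauge_u (s : Fin n → ℝ) (k : Fin n) :
    gauge θ (.ofAdd s) (u θ k : Torus θ) = phase (s k) • (u θ k : Torus θ) :=
  gaugeHom_u s k

end Torus

/-- `θ` is quite irrational if `exp (2 π i ⟨l, θ m⟩) = 1` for all `m ∈ ℤⁿ` forces `l = 0`. -/
def QuiteIrrational {n : ℕ} (θ : Matrix (Fin n) (Fin n) ℝ) : Prop :=
  ∀ l : Fin n → ℤ,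
    (∀ m : Fin n → ℤ, phase ((fun i => (l i : ℝ)) ⬝ᵥ θ *ᵥ fun j => (m j : ℝ)) = 1) → l = 0

/-! ### Free actions, coverings and connectedness -/

section Dynamics

variable {A : Type*} [CStarAlgebra A] {G : Type*} [Group G]

/-- The Ellwood map `x ⊗ y ↦ (g ↦ x α_g(y))` of an action of a finite (discrete) group. -/
def ellwoodMap (α : G →* (A ≃⋆ₐ[ℂ] A)) : A ⊗[ℂ] A →ₗ[ℂ] (G → A) :=
  TensorProduct.lift <| LinearMap.mk₂ ℂ (fun x y g => x * α g y)
    (fun x x' y => by ext g; simp [add_mul])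
    (fun c x y => by ext g; simp)
    (fun x y y' => by ext g; simp [mul_add])
    (fun c x y => by ext g; simp)

/-- An action of a finite group is free if the Ellwood map has dense range in `C(G, A) = A^G`. -/
def IsFree [Finite G] (α : G →* (A ≃⋆ₐ[ℂ] A)) : Prop :=
  DenseRange (ellwoodMap α)

/-- An action is ergodic if its fixed point algebra consists of the scalars. -/
def IsErgodic (α : G →* (A ≃⋆ₐ[ℂ] A)) : Prop :=
  ∀ a : A, (∀ g, α g a = a) → ∃ c : ℂ, a = algebraMap ℂ A c

/-- `(A, G, α)` is a covering of the quantum torus, which is embedded by `ι` as a subalgebra of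
`A`: the action is free and its fixed point algebra is the (embedded) quantum torus. -/
structure IsCovering [Finite G] {n : ℕ} {θ : Matrix (Fin n) (Fin n) ℝ}
    (α : G →* (A ≃⋆ₐ[ℂ] A)) (ι : Torus θ →⋆ₐ[ℂ] A) : Prop where
  free : IsFree α
  injective : Function.Injective ι
  range_eq : Set.range ι = {a | ∀ g, α g a = a}

/-- An action `β` of `ℝⁿ` on `A` is a lift of the gauge action of the embedded quantum torus:
it is jointly continuous, the quotient of `ℝⁿ` by its kernel is compact, and it restricts to the
gauge action. -/
structure IsGaugeLift {n : ℕ} {θ : Matrix (Fin n) (Fin n) ℝ} (ι : Torus θ →⋆ₐ[ℂ] A)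
    (β : Multiplicative (Fin n → ℝ) →* (A ≃⋆ₐ[ℂ] A)) : Prop where
  continuous : Continuous fun p : Multiplicative (Fin n → ℝ) × A => β p.1 p.2
  compact : CompactSpace (Multiplicative (Fin n → ℝ) ⧸ β.ker)
  extends_gauge : ∀ s x, β s (ι x) = ι (Torus.gauge θ s x)

/-- A covering is connected if there is an ergodic lift of the gauge action which commutes with
the action of the structure group. -/
def IsConnectedCovering {n : ℕ} {θ : Matrix (Fin n) (Fin n) ℝ}
    (α : G →* (A ≃⋆ₐ[ℂ] A)) (ι : Torus θ →⋆ₐ[ℂ] A) : Prop :=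
  ∃ β : Multiplicative (Fin n → ℝ) →* (A ≃⋆ₐ[ℂ] A),
    IsGaugeLift ι β ∧ IsErgodic β ∧ ∀ g s a, α g (β s a) = β s (α g a)

/-- A pair `(Φ, φ)` is an equivalence of C⋆-dynamical systems (with discrete groups). -/
def IsEquivalence {A' : Type*} [CStarAlgebra A'] {G' : Type*} [Group G']
    (α : G →* (A ≃⋆ₐ[ℂ] A)) (α' : G' →* (A' ≃⋆ₐ[ℂ] A'))
    (Φ : A ≃⋆ₐ[ℂ] A') (φ : G ≃* G') : Prop :=
  ∀ g a, Φ (α g a) = α' (φ g) (Φ a)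

end Dynamics

/-! ### The model coverings -/

/-- The lattice `ℤⁿ ⊆ ℝⁿ`. -/
def intLattice (n : ℕ) : AddSubgroup (Fin n → ℝ) where
  carrier := {s | ∃ m : Fin n → ℤ, s = fun k => (m k : ℝ)}
  zero_mem' := ⟨0, by ext; simp⟩
  add_mem' := by
    rintro _ _ ⟨a, rfl⟩ ⟨b, rfl⟩
    exact ⟨a + b, by ext; simp⟩
  neg_mem' := by
    rintro _ ⟨a, rfl⟩
    exact ⟨-a, by ext; simp⟩

/-- The lattice `M⁻¹ ℤⁿ ⊆ ℝⁿ` (for `M` with nonzero determinant). -/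
def invLattice {n : ℕ} (M : Matrix (Fin n) (Fin n) ℤ) : AddSubgroup (Fin n → ℝ) :=
  (intLattice n).map (Matrix.mulVecLin (M.map (Int.cast : ℤ → ℝ))⁻¹).toAddMonoidHom

/-- The group `(M⁻¹ ℤⁿ) / ℤⁿ`. -/
abbrev DeckGroup {n : ℕ} (M : Matrix (Fin n) (Fin n) ℤ) : Type :=
  Multiplicative (invLattice M ⧸ (intLattice n).addSubgroupOf (invLattice M))

theorem gauge_eq_one_of_mem {n : ℕ} (θ : Matrix (Fin n) (Fin n) ℝ) {s : Fin n → ℝ}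
    (hs : s ∈ intLattice n) : Torus.gauge θ (.ofAdd s) = 1 := by
  obtain ⟨m, rfl⟩ := hs
  have h : Torus.gaugeHom θ (fun k => (m k : ℝ)) = StarAlgHom.id ℂ (Torus θ) :=
    Torus.hom_ext fun k => by rw [Torus.gaugeHom_u, phase_int, one_smul]; rfl
  ext x
  exact DFunLike.congr_fun h x

/-- The action of `(M⁻¹ ℤⁿ) / ℤⁿ` on the quantum torus by gauge transformations. -/
def deckAction {n : ℕ} (M : Matrix (Fin n) (Fin n) ℤ) (θ : Matrix (Fin n) (Fin n) ℝ) :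
    DeckGroup M →* (Torus θ ≃⋆ₐ[ℂ] Torus θ) :=
  AddMonoidHom.toMultiplicativeLeft <|
    QuotientAddGroup.lift ((intLattice n).addSubgroupOf (invLattice M))
      ((MonoidHom.toAdditiveRight (Torus.gauge θ)).comp (invLattice M).subtype)
      fun _ hs => congrArg Additive.ofMul (gauge_eq_one_of_mem θ hs)

theorem deckAction_mk {n : ℕ} (M : Matrix (Fin n) (Fin n) ℤ) (θ : Matrix (Fin n) (Fin n) ℝ)
    (s : invLattice M) :
    deckAction M θ (.ofAdd (QuotientAddGroup.mk s)) = Torus.gauge θ (.ofAdd s.1) := rfl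

/-- The data of a model covering of the quantum torus of `θ`: an invertible integer matrix `M` and
a real skew-symmetric matrix `θ'` with `M θ' Mᵀ ∈ θ + M_n(ℤ)`. -/
structure IsModelData {n : ℕ} (θ : Matrix (Fin n) (Fin n) ℝ) (M : Matrix (Fin n) (Fin n) ℤ)
    (θ' : Matrix (Fin n) (Fin n) ℝ) : Prop where
  det_ne_zero : M.det ≠ 0
  skew : θ'ᵀ = -θ'
  rel : ∃ N : Matrix (Fin n) (Fin n) ℤ,
    M.map (Int.cast : ℤ → ℝ) * θ' * (M.map (Int.cast : ℤ → ℝ))ᵀ = θ + N.map (Int.cast : ℤ → ℝ)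

/-- The unitary `U 1 ^ (M k 1) ⋯ U n ^ (M k n)` in the quantum torus of `θ'`; these are the
generators of the copy of the quantum torus of `θ` inside that of `θ'`. -/
def modelGenerator {n : ℕ} (M : Matrix (Fin n) (Fin n) ℤ) (θ' : Matrix (Fin n) (Fin n) ℝ)
    (k : Fin n) : unitary (Torus θ') :=
  (List.ofFn fun j => Torus.u θ' j ^ M k j).prod

end QuantumTorus

namespace QuantumTorus

/-! Everything rests on the spectral subspaces of an ergodic action of `ℝⁿ`. If `a` is an
eigenvector, then `star a * a` and `a * star a` are fixed, hence scalar, so `a` is a multiple of a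
unitary. Thus every nonzero spectral subspace is a line spanned by a unitary, the spectrum is a
group, and eigenunitaries commute up to phases.

Let `β` be an ergodic lift of the gauge action. Since `β` restricts to the gauge action, its kernel
lies in `ℤⁿ`, and cocompactness puts some `N ℤⁿ` inside it (`IsGaugeLift.exists_period`). Fourier
analysis on the torus then shows that `A` is the closed span of its eigenvectors. Their characters
form a group between `ℤⁿ` and `N⁻¹ ℤⁿ`, which is free of rank `n`. A basis of it yields
eigenunitaries `W j`, and `M` expresses the standard basis in this basis (`exists_eigenunitaries`).
The `W j` satisfy the relations of a skew-symmetric `θ'`, and the resulting map from `Torus θ'` to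
`A` is onto by spanning and injective because its kernel is gauge invariant
(`exists_starAlgEquiv_torus`). The image of `u k` has the same character as `modelGenerator M θ' k`;
a gauge transformation absorbs the remaining phases, and comparing commutation relations gives `M θ'
Mᵀ ∈ θ + M_n(ℤ)` (`IsGaugeLift.exists_model`).

Each `α g` commutes with `β`, so it multiplies each `U j` by a phase and is a gauge transformation;
fixing the base places its parameter in `M⁻¹ ℤⁿ` (`exists_deckAction_eq_of_commute`). The
homomorphism from `G` to the deck group is injective by freeness and surjective because both groups
have the same fixed points (`surjective_of_forall_fixed`).

Conversely, the deck action of a model is free because the generators are eigenunitaries that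
separate the deck group. Its fixed points are computed on Fourier coefficients, and the gauge action
reparametrised by `M⁻¹` is an ergodic lift. -/

/-! ### Arithmetic of phases. -/

theorem norm_phase (t : ℝ) : ‖phase t‖ = 1 := by
  rw [phase, show (2 * Real.pi * Complex.I * t : ℂ) = ((2 * Real.pi * t : ℝ) : ℂ) * Complex.I by
    push_cast; ring, Complex.norm_exp_ofReal_mul_I]

theorem phase_ne_zero (t : ℝ) : phase t ≠ 0 := Complex.exp_ne_zero _

theorem phase_neg (t : ℝ) : phase (-t) = (phase t)⁻¹ := by
  exact eq_inv_of_mul_eq_one_left (by rw [← phase_add, neg_add_cancel, phase_zero])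

theorem phase_sub (s t : ℝ) : phase (s - t) = phase s * (phase t)⁻¹ := by
  rw [sub_eq_add_neg, phase_add, phase_neg]

theorem phase_eq_one_iff (t : ℝ) : phase t = 1 ↔ ∃ m : ℤ, t = m := by
  refine ⟨fun h => ?_, ?_⟩
  · rw [phase, Complex.exp_eq_one_iff] at h
    obtain ⟨m, hm⟩ := h
    refine ⟨m, ?_⟩
    have : (2 * Real.pi * Complex.I : ℂ) ≠ 0 := by simp [Real.pi_ne_zero]
    have h2 : (2 * Real.pi * Complex.I : ℂ) * t = (2 * Real.pi * Complex.I : ℂ) * m := by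
      rw [hm]; ring
    exact_mod_cast mul_left_cancel₀ this h2
  · rintro ⟨m, rfl⟩
    exact phase_int m

theorem phase_eq_phase_iff (s t : ℝ) : phase s = phase t ↔ ∃ m : ℤ, s - t = m := by
  rw [← phase_eq_one_iff, phase_sub, mul_inv_eq_one₀ (phase_ne_zero t)]

theorem exists_phase_eq {c : ℂ} (hc : ‖c‖ = 1) : ∃ t : ℝ, phase t = c := by
  refine ⟨c.arg / (2 * Real.pi), ?_⟩
  have h := Complex.norm_mul_exp_arg_mul_I c
  rw [hc, Complex.ofReal_one, one_mul] at h
  conv_rhs => rw [← h]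
  rw [phase]
  congr 1
  push_cast
  field_simp

theorem continuous_phase : Continuous phase := by
  unfold phase
  fun_prop

theorem eq_zero_of_phase_mul_eq_one {r : ℝ} (h : ∀ s : ℝ, phase (r * s) = 1) : r = 0 := by
  by_contra hr
  -- At `s = 1 / (2 r)` the product `r * s` is `1/2`, which is not an integer.
  obtain ⟨m, hm⟩ := (phase_eq_one_iff _).1 (h (1 / (2 * r)))
  field_simp at hm
  have : (1 : ℤ) = m * 2 := by exact_mod_cast (by linarith : (1 : ℝ) = m * 2)
  omega

/-! ### Spectral subspaces of an action of `ℝⁿ` -/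

section Spectral

variable {n : ℕ} {A : Type*} [CStarAlgebra A]

/-- The spectral subspace of an action of `ℝⁿ` for the character `s ↦ exp (2 π i ⟨χ, s⟩)`. -/
def spec (β : Multiplicative (Fin n → ℝ) →* (A ≃⋆ₐ[ℂ] A)) (χ : Fin n → ℝ) : Submodule ℂ A where
  carrier := {a | ∀ s : Fin n → ℝ, β (.ofAdd s) a = phase (χ ⬝ᵥ s) • a}
  zero_mem' s := by simp
  add_mem' ha hb s := by rw [map_add, ha s, hb s, smul_add]
  smul_mem' c a ha s := by rw [map_smul, ha s, smul_comm]

variable {β : Multiplicative (Fin n → ℝ) →* (A ≃⋆ₐ[ℂ] A)}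

theorem mem_spec {χ : Fin n → ℝ} {a : A} :
    a ∈ spec β χ ↔ ∀ s : Fin n → ℝ, β (.ofAdd s) a = phase (χ ⬝ᵥ s) • a := Iff.rfl

theorem one_mem_spec : (1 : A) ∈ spec β 0 := fun s => by simp [phase_zero]

theorem mul_mem_spec {χ ξ : Fin n → ℝ} {a b : A} (ha : a ∈ spec β χ) (hb : b ∈ spec β ξ) :
    a * b ∈ spec β (χ + ξ) := fun s => by
  rw [map_mul, ha s, hb s, smul_mul_smul_comm, ← phase_add, add_dotProduct]

theorem star_mem_spec {χ : Fin n → ℝ} {a : A} (ha : a ∈ spec β χ) :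
    star a ∈ spec β (-χ) := fun s => by
  rw [map_star, ha s, star_smul, star_phase, neg_dotProduct]

theorem unitary_inv_mem_spec {χ : Fin n → ℝ} {v : unitary A} (hv : (v : A) ∈ spec β χ) :
    ((v⁻¹ : unitary A) : A) ∈ spec β (-χ) := star_mem_spec hv

theorem unitary_zpow_mem_spec {χ : Fin n → ℝ} {v : unitary A} (hv : (v : A) ∈ spec β χ) (z : ℤ) :
    ((v ^ z : unitary A) : A) ∈ spec β ((z : ℝ) • χ) := by
  induction z using Int.induction_on with
  | zero => simpa using one_mem_spec
  | succ k ih =>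
    have := mul_mem_spec ih hv
    rw [zpow_add_one, Submonoid.coe_mul]
    convert this using 2
    push_cast
    module
  | pred k ih =>
    have := mul_mem_spec ih (unitary_inv_mem_spec hv)
    rw [zpow_sub_one, Submonoid.coe_mul]
    convert this using 2
    push_cast
    module

/-- The ordered monomial `W 1 ^ z 1 ⋯ W n ^ z n`. -/
def monomial {U : Type*} [Group U] {m : ℕ} (W : Fin m → U) (z : Fin m → ℤ) : U :=
  (List.ofFn fun j => W j ^ z j).prod

theorem monomial_succ {U : Type*} [Group U] {m : ℕ} (W : Fin (m + 1) → U) (z : Fin (m + 1) → ℤ) :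
    monomial W z = W 0 ^ z 0 * monomial (fun j => W j.succ) (fun j => z j.succ) := by
  simp [monomial, List.ofFn_succ]

theorem monomial_mem_spec {m : ℕ} {W : Fin m → unitary A} {χ : Fin m → Fin n → ℝ}
    (hW : ∀ j, (W j : A) ∈ spec β (χ j)) (z : Fin m → ℤ) :
    ((monomial W z : unitary A) : A) ∈ spec β (∑ j, (z j : ℝ) • χ j) := by
  induction m with
  | zero => simpa [monomial] using one_mem_spec
  | succ m ih =>
    rw [monomial_succ, Fin.sum_univ_succ]
    exact mul_mem_spec (unitary_zpow_mem_spec (hW 0) _) (ih (fun j => hW j.succ) _)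

theorem map_monomial {U V : Type*} [Group U] [Group V] (f : U →* V) {m : ℕ} (W : Fin m → U)
    (z : Fin m → ℤ) : f (monomial W z) = monomial (fun j => f (W j)) z := by
  induction m with
  | zero => simp [monomial]
  | succ m ih => rw [monomial_succ, monomial_succ, map_mul, map_zpow, ih]

theorem isErgodic_iff_mem_spec : IsErgodic β ↔
    ∀ a ∈ spec β 0, ∃ c : ℂ, a = algebraMap ℂ A c := by
  simp only [IsErgodic, mem_spec, zero_dotProduct, phase_zero, one_smul]
  rfl

/-- The element `star v * a` has trivial character and is therefore scalar: a spectral subspace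
containing a unitary is a line. -/
theorem IsErgodic.eq_smul (he : IsErgodic β) {χ : Fin n → ℝ} {v : unitary A} {a : A}
    (hv : (v : A) ∈ spec β χ) (ha : a ∈ spec β χ) : ∃ c : ℂ, a = c • (v : A) := by
  obtain ⟨c, hc⟩ := isErgodic_iff_mem_spec.1 he ((star v : A) * a)
    (by simpa using mul_mem_spec (star_mem_spec hv) ha)
  refine ⟨c, ?_⟩
  have : (v : A) * ((star v : A) * a) = a := by
    rw [← mul_assoc, Unitary.mul_star_self_of_mem v.2, one_mul]
  rw [← this, hc, ← Algebra.commutes, ← Algebra.smul_def]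

theorem norm_eq_one_of_unitary_smul [Nontrivial A] {v w : unitary A} {c : ℂ}
    (h : (w : A) = c • (v : A)) : ‖c‖ = 1 := by
  have h1 := CStarRing.norm_coe_unitary w
  rwa [h, norm_smul, CStarRing.norm_coe_unitary, mul_one] at h1

theorem IsErgodic.exists_phase_smul [Nontrivial A] (he : IsErgodic β) {χ : Fin n → ℝ}
    {v w : unitary A} (hv : (v : A) ∈ spec β χ) (hw : (w : A) ∈ spec β χ) :
    ∃ t : ℝ, (w : A) = phase t • (v : A) := by
  obtain ⟨c, hc⟩ := he.eq_smul hv hw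
  obtain ⟨t, rfl⟩ := exists_phase_eq (norm_eq_one_of_unitary_smul hc)
  exact ⟨t, hc⟩

open scoped ComplexOrder in
-- Both `star a * a` and `a * star a` are scalars. Associativity of `a * star a * a` shows that they
-- agree, and positivity identifies them with `‖a‖ ^ 2`, so `a / ‖a‖` is unitary.
theorem IsErgodic.exists_unitary (he : IsErgodic β) {χ : Fin n → ℝ} {a : A}
    (ha : a ∈ spec β χ) (ha0 : a ≠ 0) : ∃ v : unitary A, (v : A) ∈ spec β χ := by
  have : Nontrivial A := ⟨a, 0, ha0⟩
  obtain ⟨c, hc⟩ := isErgodic_iff_mem_spec.1 he (star a * a)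
    (by simpa using mul_mem_spec (star_mem_spec ha) ha)
  obtain ⟨d, hd⟩ := isErgodic_iff_mem_spec.1 he (a * star a)
    (by simpa using mul_mem_spec ha (star_mem_spec ha))
  have hcd : c = d := by
    have h1 : a * (star a * a) = (a * star a) * a := (mul_assoc _ _ _).symm
    rw [hc, hd, ← Algebra.commutes, ← Algebra.smul_def, ← Algebra.smul_def] at h1
    exact smul_left_injective ℂ ha0 h1
  have hn : c = ((‖a‖ ^ 2 : ℝ) : ℂ) := by
    have h1 : ‖c‖ = ‖a‖ ^ 2 := by
      rw [← norm_algebraMap' A c, ← hc, CStarRing.norm_star_mul_self, sq]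
    have h2 : c ∈ spectrum ℂ (star a * a) := by
      rw [hc, spectrum.scalar_eq]
      rfl
    -- The scalar lies in the spectrum of the positive element `star a * a`.
    have h3 : 0 ≤ c.re ∧ c.im = 0 := by
      let _ := CStarAlgebra.spectralOrder A
      have := CStarAlgebra.spectralOrderedRing A
      have h4 := spectrum_nonneg_of_nonneg (star_mul_self_nonneg a) h2
      exact ⟨(Complex.le_def.1 h4).1, (Complex.le_def.1 h4).2.symm⟩
    rw [← h1]
    have h5 : c = (c.re : ℂ) := Complex.ext (by simp) (by simp [h3.2])
    rw [h5, Complex.norm_real, Real.norm_of_nonneg h3.1]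
  have hna : (‖a‖ : ℂ) ≠ 0 := by simpa using ha0
  refine ⟨⟨(‖a‖ : ℂ)⁻¹ • a, ?_⟩, Submodule.smul_mem _ _ ha⟩
  rw [Unitary.mem_iff, star_smul, smul_mul_smul_comm, smul_mul_smul_comm, hc, hd, ← hcd, hn]
  have : star ((‖a‖ : ℂ)⁻¹) = (‖a‖ : ℂ)⁻¹ := by simp
  rw [this, mul_comm _ (‖a‖ : ℂ)⁻¹, and_self, Algebra.smul_def, ← map_mul]
  rw [Complex.ofReal_pow, show (‖a‖ : ℂ)⁻¹ * (‖a‖ : ℂ)⁻¹ * (‖a‖ : ℂ) ^ 2 = 1 by field_simp, map_one]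

/-! ### Unitaries commuting up to a phase -/

theorem phase_comm_mul {x y z : unitary A} {a b : ℝ}
    (h1 : (x : A) * y = phase a • ((y : A) * x)) (h2 : (x : A) * z = phase b • ((z : A) * x)) :
    (x : A) * (y * z : unitary A) = phase (a + b) • (((y * z : unitary A) : A) * x) := by
  rw [Submonoid.coe_mul, ← mul_assoc, h1, smul_mul_assoc, mul_assoc, h2, mul_smul_comm, smul_smul,
    phase_add, mul_assoc]

theorem phase_comm_inv {x y : unitary A} {a : ℝ}
    (h : (x : A) * y = phase a • ((y : A) * x)) :
    (x : A) * (y⁻¹ : unitary A) = phase (-a) • (((y⁻¹ : unitary A) : A) * x) := by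
  have hy : ((y⁻¹ : unitary A) : A) * y = 1 := by
    rw [← Submonoid.coe_mul, inv_mul_cancel, Submonoid.coe_one]
  have hy' : (y : A) * ((y⁻¹ : unitary A) : A) = 1 := by
    rw [← Submonoid.coe_mul, mul_inv_cancel, Submonoid.coe_one]
  have h1 : ((y⁻¹ : unitary A) : A) * x = phase a • ((x : A) * (y⁻¹ : unitary A)) := by
    calc ((y⁻¹ : unitary A) : A) * x
        = ((y⁻¹ : unitary A) : A) * ((x : A) * y) * (y⁻¹ : unitary A) := by
          rw [mul_assoc, mul_assoc, hy', mul_one]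
      _ = _ := by rw [h, mul_smul_comm, ← mul_assoc, hy, one_mul, smul_mul_assoc]
  rw [h1, smul_smul, ← phase_add, neg_add_cancel, phase_zero, one_smul]

theorem phase_comm_symm {x y : unitary A} {a : ℝ}
    (h : (x : A) * y = phase a • ((y : A) * x)) :
    (y : A) * x = phase (-a) • ((x : A) * y) := by
  rw [h, smul_smul, ← phase_add, neg_add_cancel, phase_zero, one_smul]

theorem phase_comm_zpow {x y : unitary A} {a : ℝ}
    (h : (x : A) * y = phase a • ((y : A) * x)) (z : ℤ) :
    (x : A) * (y ^ z : unitary A) = phase (z * a) • (((y ^ z : unitary A) : A) * x) := by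
  induction z using Int.induction_on with
  | zero => simp [phase_zero]
  | succ k ih =>
    rw [zpow_add_one, phase_comm_mul ih h]
    congr 2
    push_cast
    ring
  | pred k ih =>
    rw [zpow_sub_one, phase_comm_mul ih (phase_comm_inv h)]
    congr 2
    push_cast
    ring

theorem phase_comm_monomial_right {m : ℕ} {x : unitary A} {W : Fin m → unitary A} {a : Fin m → ℝ}
    (h : ∀ j, (x : A) * W j = phase (a j) • ((W j : A) * x)) (z : Fin m → ℤ) :
    (x : A) * (monomial W z : unitary A) = phase (∑ j, z j * a j) • (((monomial W z : unitary A) : A) * x) := by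
  induction m with
  | zero => simp [monomial, phase_zero]
  | succ m ih =>
    rw [monomial_succ, Fin.sum_univ_succ]
    exact phase_comm_mul (phase_comm_zpow (h 0) _) (ih (fun j => h j.succ) _)

theorem phase_comm_monomial {θ : Matrix (Fin n) (Fin n) ℝ} {W : Fin n → unitary A}
    (hW : IsTuple θ W) (y z : Fin n → ℤ) :
    ((monomial W y : unitary A) : A) * (monomial W z : unitary A) =
      phase ((fun i => (y i : ℝ)) ⬝ᵥ θ *ᵥ fun j => (z j : ℝ)) •
        (((monomial W z : unitary A) : A) * (monomial W y : unitary A)) := by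
  have h1 (k : Fin n) := phase_comm_symm (phase_comm_monomial_right (hW k) z)
  -- Generators are moved past the second monomial, then the first monomial is built up on the other
  -- side; the two reversals cancel in sign.
  have h2 := phase_comm_symm (phase_comm_monomial_right h1 y)
  rw [h2]
  congr 2
  simp only [dotProduct, Matrix.mulVec]
  rw [← Finset.sum_neg_distrib]
  refine Finset.sum_congr rfl fun i _ => ?_
  rw [mul_neg, neg_neg]
  congr 1
  exact Finset.sum_congr rfl fun j _ => mul_comm _ _

end Spectral

/-! ### The quantum torus is nontrivial -/

section Nontrivial

/-- Unimodular multiples of a permuted Hilbert basis form a Hilbert basis, and `V` is the change of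
basis. -/
theorem _root_.HilbertBasis.exists_unitary_weighted_permutation {ι H : Type*}
    [NormedAddCommGroup H] [InnerProductSpace ℂ H] [CompleteSpace H] (b : HilbertBasis ι ℂ H)
    (e : ι ≃ ι) (c : ι → ℂ) (hc : ∀ i, ‖c i‖ = 1) :
    ∃ V : unitary (H →L[ℂ] H), ∀ i, (V : H →L[ℂ] H) (b i) = c i • b (e i) := by
  classical
  have hc0 (i : ι) : c i ≠ 0 := fun h => by simpa [h] using hc i
  have ho : Orthonormal ℂ fun i => c i • b (e i) := by
    rw [orthonormal_iff_ite]
    intro i j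
    rw [inner_smul_left, inner_smul_right, orthonormal_iff_ite.1 b.orthonormal, e.injective.eq_iff]
    split_ifs with h
    · subst h
      rw [mul_one, Complex.conj_mul', hc]
      simp
    · simp
  have hs : ⊤ ≤ (Submodule.span ℂ (Set.range fun i => c i • b (e i))).topologicalClosure := by
    rw [← b.dense_span]
    refine Submodule.topologicalClosure_mono (Submodule.span_le.2 ?_)
    rintro _ ⟨i, rfl⟩
    have h : b i = (c (e.symm i))⁻¹ • (c (e.symm i) • b (e (e.symm i))) := by
      rw [smul_smul, inv_mul_cancel₀ (hc0 _), one_smul, e.apply_symm_apply]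
    rw [h]
    exact Submodule.smul_mem _ _ (Submodule.subset_span ⟨e.symm i, rfl⟩)
  let b' := HilbertBasis.mk ho hs
  refine ⟨Unitary.linearIsometryEquiv.symm (b.repr.trans b'.repr.symm), fun i => ?_⟩
  change b'.repr.symm (b.repr (b i)) = _
  rw [b.repr_self, b'.repr_symm_single, HilbertBasis.coe_mk]

theorem _root_.HilbertBasis.ext_continuousLinearMap {ι H F : Type*}
    [NormedAddCommGroup H] [InnerProductSpace ℂ H] [NormedAddCommGroup F] [NormedSpace ℂ F]
    (b : HilbertBasis ι ℂ H) {S T : H →L[ℂ] F} (h : ∀ i, S (b i) = T (b i)) : S = T :=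
  ContinuousLinearMap.ext_on (Submodule.dense_iff_topologicalClosure_eq_top.2 b.dense_span)
    (by rintro _ ⟨i, rfl⟩; exact h i)

variable {n : ℕ} {θ : Matrix (Fin n) (Fin n) ℝ}

/-- A skew-symmetric matrix is realised by unitaries on `ℓ²(ℤⁿ)`. -/
theorem exists_isTuple_of_skew (hθ : θᵀ = -θ) :
    ∃ V : Fin n → unitary (lp (fun _ : Fin n → ℤ => ℂ) 2 →L[ℂ] lp (fun _ : Fin n → ℤ => ℂ) 2),
      IsTuple θ V := by
  let b : HilbertBasis (Fin n → ℤ) ℂ (lp (fun _ : Fin n → ℤ => ℂ) 2) :=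
    .ofRepr (LinearIsometryEquiv.refl ℂ _)
  -- Twisted shifts: `V k` moves `m` to `m + e_k` with half of the row pairing as phase. Exchanging
  -- `V k` and `V l` costs `(θ k l - θ l k) / 2`, which is `θ k l` by skew symmetry.
  have h (k : Fin n) := b.exists_unitary_weighted_permutation
    (Equiv.addRight (Pi.single k 1)) (fun m => phase (∑ l, θ k l * m l / 2))
    (fun m => norm_phase _)
  choose V hV using h
  refine ⟨V, fun k l => b.ext_continuousLinearMap fun m => ?_⟩
  have hsum (k l : Fin n) : ∑ i, θ k i * ((m + Pi.single l 1 : Fin n → ℤ) i : ℝ) / 2 =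
      ∑ i, θ k i * m i / 2 + θ k l / 2 := by
    simp only [Pi.add_apply, Int.cast_add, mul_add, add_div, Finset.sum_add_distrib]
    congr 1
    rw [Finset.sum_eq_single l]
    · simp
    · intro i _ hi
      simp [Pi.single_eq_of_ne hi]
    · simp
  change (V k).1 ((V l).1 (b m)) =
    phase (θ k l) • (V l).1 ((V k).1 (b m))
  rw [hV, map_smul, hV, hV, map_smul, hV, smul_smul, smul_smul, smul_smul]
  simp only [Equiv.coe_addRight, hsum]
  rw [add_right_comm]
  congr 1
  simp only [← phase_add]
  congr 1
  have := congrFun (congrFun hθ k) l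
  simp only [Matrix.transpose_apply, Matrix.neg_apply] at this
  rw [this]
  ring

/-- The zero seminorm is among those defining the universal norm, so nontriviality requires an
actual representation on a nonzero space. -/
theorem Torus.nontrivial (hθ : θᵀ = -θ) : Nontrivial (Torus θ) := by
  obtain ⟨V, hV⟩ := exists_isTuple_of_skew hθ
  have : Nontrivial (lp (fun _ : Fin n → ℤ => ℂ) 2) :=
    ⟨lp.single 2 0 (1 : ℂ), 0, fun h => by
      have := congrArg (fun f : lp (fun _ : Fin n → ℤ => ℂ) 2 => f 0) h
      simp at this⟩
  exact (Torus.lift V hV).toAlgHom.toRingHom.domain_nontrivial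

end Nontrivial

/-! ### Fourier analysis of periodic actions of `ℝⁿ` -/

section Fourier

open MeasureTheory UnitAddTorus

/-- Hahn–Banach separation: a functional whose real part is bounded above on a subspace vanishes
there. -/
theorem _root_.Submodule.mem_topologicalClosure_of_forall_dual {E : Type*} [NormedAddCommGroup E]
    [NormedSpace ℂ E] (S : Submodule ℂ E) (x : E)
    (h : ∀ f : E →L[ℂ] ℂ, (∀ y ∈ S, f y = 0) → f x = 0) : x ∈ S.topologicalClosure := by
  by_contra hx
  obtain ⟨f, u, hfu, hux⟩ := RCLike.geometric_hahn_banach_closed_point (𝕜 := ℂ)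
    (s := (S.topologicalClosure : Set E)) (S.topologicalClosure.restrictScalars ℝ).convex
    S.isClosed_topologicalClosure hx
  have h0 (y : E) (hy : y ∈ S) : f y = 0 := by
    by_contra hne
    -- This multiple of `y` is sent exactly to the bound `u`, which must be strict.
    have h1 := hfu ((u : ℂ) • (f y)⁻¹ • y)
      (S.le_topologicalClosure (S.smul_mem _ (S.smul_mem _ hy)))
    rw [map_smul f, map_smul f, smul_eq_mul, smul_eq_mul, inv_mul_cancel₀ hne] at h1
    simp at h1
  have h2 := hfu 0 (Submodule.zero_mem _)
  rw [h f h0] at hux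
  simp at h2 hux
  linarith

theorem mFourier_coe {n : ℕ} (m : Fin n → ℤ) (s : Fin n → ℝ) :
    mFourier m (fun i => (s i : UnitAddCircle)) = phase ((fun i => (m i : ℝ)) ⬝ᵥ s) := by
  simp only [mFourier, ContinuousMap.coe_mk, fourier_coe_apply, phase, ← Complex.exp_sum, dotProduct]
  congr 1
  push_cast
  rw [Finset.mul_sum]
  refine Finset.sum_congr rfl fun i _ => ?_
  ring_nf

theorem isOpenQuotientMap_toUnitAddTorus (n : ℕ) :
    IsOpenQuotientMap fun (s : Fin n → ℝ) (i : Fin n) => (s i : UnitAddCircle) :=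
  IsOpenQuotientMap.piMap fun _ => QuotientAddGroup.isOpenQuotientMap_mk

-- Haar measure of total mass one: its invariance makes Fourier coefficients eigenvectors, and its
-- normalisation makes the zeroth coefficient fix invariant elements.
local instance : MeasureSpace UnitAddCircle := ⟨AddCircle.haarAddCircle⟩

local instance : Measure.IsAddHaarMeasure (volume : Measure UnitAddCircle) :=
  inferInstanceAs (Measure.IsAddHaarMeasure AddCircle.haarAddCircle)

local instance : IsProbabilityMeasure (volume : Measure UnitAddCircle) :=
  inferInstanceAs (IsProbabilityMeasure AddCircle.haarAddCircle)

variable {n : ℕ} {A : Type*} [CStarAlgebra A]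

/-- The orbit of `a` as a function on the torus, for an action of `ℝⁿ` that is trivial on `ℤⁿ`. -/
def torusOrbit (β : Multiplicative (Fin n → ℝ) →* (A ≃⋆ₐ[ℂ] A)) (a : A)
    (t : UnitAddTorus (Fin n)) : A :=
  β (.ofAdd fun i => (t i).out) a

/-- The Fourier coefficients of the orbit of `a`. -/
def fourierProj (β : Multiplicative (Fin n → ℝ) →* (A ≃⋆ₐ[ℂ] A)) (m : Fin n → ℤ) (a : A) : A :=
  ∫ t : UnitAddTorus (Fin n), mFourier (-m) t • torusOrbit β a t

/-- An action of `ℝⁿ` with continuous orbits which is trivial on `ℤⁿ`. -/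
structure IsPeriodic (β : Multiplicative (Fin n → ℝ) →* (A ≃⋆ₐ[ℂ] A)) : Prop where
  continuous : ∀ a, Continuous fun s : Fin n → ℝ => β (.ofAdd s) a
  periodic : ∀ m : Fin n → ℤ, β (.ofAdd fun i => (m i : ℝ)) = 1

namespace IsPeriodic

variable {β : Multiplicative (Fin n → ℝ) →* (A ≃⋆ₐ[ℂ] A)} (hβ : IsPeriodic β)

include hβ

/-- The chosen representatives differ from `s` by an integer vector, which acts trivially. -/
theorem torusOrbit_coe (a : A) (s : Fin n → ℝ) :
    torusOrbit β a (fun i => (s i : UnitAddCircle)) = β (.ofAdd s) a := by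
  have h (i : Fin n) : ∃ m : ℤ, ((s i : UnitAddCircle)).out = m + s i := by
    have h1 : (((s i : UnitAddCircle)).out : UnitAddCircle) = (s i : UnitAddCircle) :=
      Quotient.out_eq' _
    obtain ⟨m, hm⟩ := QuotientAddGroup.eq_iff_sub_mem.1 h1
    refine ⟨m, ?_⟩
    simp at hm
    linarith
  choose m hm using h
  have h2 : (fun i => ((s i : UnitAddCircle)).out) = (fun i => (m i : ℝ)) + s := funext hm
  rw [torusOrbit, h2, ofAdd_add, map_mul, hβ.periodic, one_mul]

theorem continuous_torusOrbit (a : A) : Continuous (torusOrbit β a) := by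
  rw [← (isOpenQuotientMap_toUnitAddTorus n).continuous_comp_iff]
  refine (hβ.continuous a).congr fun s => (hβ.torusOrbit_coe a s).symm

theorem torusOrbit_add (a : A) (s : Fin n → ℝ) (t : UnitAddTorus (Fin n)) :
    torusOrbit β a ((fun i => (s i : UnitAddCircle)) + t) = β (.ofAdd s) (torusOrbit β a t) := by
  obtain ⟨r, rfl⟩ := (isOpenQuotientMap_toUnitAddTorus n).surjective t
  have : (fun i => (s i : UnitAddCircle)) + (fun i => (r i : UnitAddCircle)) =
      fun i => ((s + r) i : UnitAddCircle) := by
    ext i; simp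
  rw [this, hβ.torusOrbit_coe, hβ.torusOrbit_coe, ofAdd_add, map_mul]
  rfl

theorem integrable_smul_torusOrbit (a : A) (g : C(UnitAddTorus (Fin n), ℂ)) :
    Integrable fun t => g t • torusOrbit β a t :=
  (g.continuous.smul (hβ.continuous_torusOrbit a)).integrable_of_hasCompactSupport
    (HasCompactSupport.of_compactSpace _)

/-- Translating the integration variable by `s` leaves Haar measure unchanged and multiplies the
kernel `mFourier (-m)` by the inverse of the required phase. -/
theorem fourierProj_mem_spec (m : Fin n → ℤ) (a : A) :
    fourierProj β m a ∈ spec β fun i => (m i : ℝ) := fun s => by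
  let L : A →L[ℂ] A :=
    ⟨(β (.ofAdd s)).toAlgEquiv.toLinearMap, (StarAlgEquiv.isometry (β (.ofAdd s))).continuous⟩
  have h1 : β (.ofAdd s) (fourierProj β m a) =
      ∫ t : UnitAddTorus (Fin n), L (mFourier (-m) t • torusOrbit β a t) :=
    (L.integral_comp_comm (hβ.integrable_smul_torusOrbit a _)).symm
  have h2 (t : UnitAddTorus (Fin n)) : L (mFourier (-m) t • torusOrbit β a t) =
      phase ((fun i => (m i : ℝ)) ⬝ᵥ s) •
        (mFourier (-m) ((fun i => (s i : UnitAddCircle)) + t) •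
          torusOrbit β a ((fun i => (s i : UnitAddCircle)) + t)) := by
    have h3 : mFourier (-m) ((fun i => (s i : UnitAddCircle)) + t) =
        mFourier (-m) (fun i => (s i : UnitAddCircle)) * mFourier (-m) t := by
      simp only [mFourier, ContinuousMap.coe_mk, Pi.add_apply, fourier_apply, smul_add,
        AddCircle.toCircle_add, Circle.coe_mul, Finset.prod_mul_distrib]
    have h4 : (fun i => ((-m) i : ℝ)) = -fun i => (m i : ℝ) := by
      ext i; simp
    rw [hβ.torusOrbit_add, h3, mFourier_coe, h4, neg_dotProduct, smul_smul, ← mul_assoc,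
      ← phase_add, add_neg_cancel, phase_zero, one_mul, map_smul]
    rfl
  simp_rw [h1, h2]
  rw [integral_smul, integral_add_left_eq_self (fun t => mFourier (-m) t • torusOrbit β a t)]
  rfl

/-- Every element lies in the closed span of its Fourier coefficients. -/
theorem mem_closure_span_fourierProj (a : A) :
    a ∈ (Submodule.span ℂ (Set.range fun m => fourierProj β m a)).topologicalClosure := by
  refine Submodule.mem_topologicalClosure_of_forall_dual _ _ fun f hf => ?_
  -- By Hahn–Banach it suffices that a functional killing all coefficients kills `a`. The scalar
  -- function `h` then has vanishing Fourier coefficients, and `h` is `f a` at the identity.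
  let h : C(UnitAddTorus (Fin n), ℂ) :=
    ⟨fun t => f (torusOrbit β a t), f.continuous.comp (hβ.continuous_torusOrbit a)⟩
  have hint (g : C(UnitAddTorus (Fin n), ℂ)) : Integrable fun t => g t * h t :=
    (g * h).continuous.integrable_of_hasCompactSupport (HasCompactSupport.of_compactSpace _)
  have hm (m : Fin n → ℤ) : ∫ t, mFourier m t * h t = 0 := by
    have h1 := hf _ (Submodule.subset_span ⟨-m, rfl⟩)
    simp only [fourierProj, neg_neg] at h1
    rw [← f.integral_comp_comm (hβ.integrable_smul_torusOrbit a _)] at h1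
    rw [← h1]
    exact integral_congr_ae (.of_forall fun t => (map_smul f _ _).symm)
  let Λ : C(UnitAddTorus (Fin n), ℂ) →L[ℂ] ℂ :=
    LinearMap.mkContinuous
      { toFun := fun g => ∫ t, g t * h t
        map_add' := fun g g' => by
          rw [← integral_add (hint g) (hint g')]
          exact integral_congr_ae (.of_forall fun t => add_mul _ _ _)
        map_smul' := fun c g => by
          rw [RingHom.id_apply, ← integral_smul]
          exact integral_congr_ae (.of_forall fun t => mul_assoc _ _ _) } ‖h‖ fun g => by
      refine (norm_integral_le_of_norm_le_const (C := ‖h‖ * ‖g‖) (.of_forall fun t => ?_)).trans ?_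
      · rw [norm_mul, mul_comm]
        exact mul_le_mul (h.norm_coe_le_norm t) (g.norm_coe_le_norm t) (norm_nonneg _)
          (norm_nonneg _)
      · simp
  -- Trigonometric polynomials are uniformly dense. Testing `Λ` on the conjugate of `h` afterwards
  -- gives `∫ ‖h‖² = 0`, and continuity forces `h = 0`.
  have hΛ : Λ = 0 := by
    refine ContinuousLinearMap.ext_on (s := Set.range (mFourier (d := Fin n)))
      (Submodule.dense_iff_topologicalClosure_eq_top.2 span_mFourier_closure_eq_top) ?_
    rintro _ ⟨m, rfl⟩
    exact hm m
  have h2 : ∫ t, ‖h t‖ ^ 2 = 0 := by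
    have h3 : Λ (star h) = 0 := by rw [hΛ]; rfl
    have h4 : Λ (star h) = ((∫ t, ‖h t‖ ^ 2 : ℝ) : ℂ) := by
      rw [← integral_complex_ofReal]
      refine integral_congr_ae (.of_forall fun t => ?_)
      change star (h t) * h t = _
      rw [Complex.star_def, Complex.conj_mul']
      push_cast
      rfl
    rw [h4] at h3
    exact_mod_cast h3
  have hc : Continuous fun t => ‖h t‖ ^ 2 := by fun_prop
  have hz : (0 : C(UnitAddTorus (Fin n), ℂ)) = h := by
    rw [integral_eq_zero_iff_of_nonneg (fun t => by positivity)
      (hc.integrable_of_hasCompactSupport (HasCompactSupport.of_compactSpace _)),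
      hc.ae_eq_iff_eq _ continuous_zero] at h2
    ext t
    have := congrFun h2 t
    exact (norm_eq_zero.1 (pow_eq_zero_iff two_ne_zero |>.1 this)).symm
  have h0 := congrArg (fun k : C(UnitAddTorus (Fin n), ℂ) => k (fun _ => ((0 : ℝ) : UnitAddCircle))) hz
  change 0 = f (torusOrbit β a _) at h0
  rw [hβ.torusOrbit_coe a (fun _ => 0)] at h0
  rw [h0]
  congr 1
  change a = β 1 a
  rw [map_one]
  rfl

theorem map_fourierProj_eq_zero {B : Type*} [CStarAlgebra B] (ψ : A →L[ℂ] B) (a : A)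
    (h : ∀ s, ψ (β (.ofAdd s) a) = 0) (m : Fin n → ℤ) : ψ (fourierProj β m a) = 0 := by
  rw [fourierProj, ← ψ.integral_comp_comm (hβ.integrable_smul_torusOrbit a _)]
  refine integral_eq_zero_of_ae (.of_forall fun t => ?_)
  change ψ (_ • β _ a) = 0
  rw [map_smul, h, smul_zero]

theorem apply_fourierProj {τ : A ≃⋆ₐ[ℂ] A} (hτ : ∀ s a, τ (β (.ofAdd s) a) = β (.ofAdd s) (τ a))
    (m : Fin n → ℤ) (a : A) : τ (fourierProj β m a) = fourierProj β m (τ a) := by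
  let L : A →L[ℂ] A := ⟨τ.toAlgEquiv.toLinearMap, (StarAlgEquiv.isometry τ).continuous⟩
  rw [fourierProj, fourierProj]
  refine (L.integral_comp_comm (hβ.integrable_smul_torusOrbit a _)).symm.trans ?_
  refine integral_congr_ae (.of_forall fun t => (map_smul L _ _).trans ?_)
  exact congrArg _ (hτ _ a)

end IsPeriodic

end Fourier

/-! ### Monomials in a tuple of unitaries -/

section Monomials

variable {n : ℕ} {A : Type*} [CStarAlgebra A]

theorem monomial_zero {U : Type*} [Group U] {m : ℕ} (W : Fin m → U) : monomial W 0 = 1 := by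
  simp [monomial]

theorem monomial_single {U : Type*} [Group U] {m : ℕ} (W : Fin m → U) (k : Fin m) :
    monomial W (Pi.single k 1) = W k := by
  induction m with
  | zero => exact k.elim0
  | succ m ih =>
    rw [monomial_succ]
    refine Fin.cases ?_ (fun j => ?_) k
    · have : (fun j : Fin m => (Pi.single 0 1 : Fin (m + 1) → ℤ) j.succ) = 0 := by
        ext j; simp
      rw [this, monomial_zero]
      simp
    · have : (fun i : Fin m => (Pi.single j.succ 1 : Fin (m + 1) → ℤ) i.succ) = Pi.single j 1 := by
        ext i; simp [Pi.single_apply]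
      rw [this, ih]
      simp

/-- By induction on the number of generators: `W 0 ^ z 0` passes the tail of the first monomial at
the cost of a phase, and the tails are multiplied inductively. -/
theorem exists_monomial_mul {m : ℕ} {W : Fin m → unitary A}
    (hW : ∀ k l, ∃ a : ℝ, (W k : A) * W l = phase a • ((W l : A) * W k)) (y z : Fin m → ℤ) :
    ∃ a : ℝ, ((monomial W y : unitary A) : A) * (monomial W z : unitary A) =
      phase a • ((monomial W (y + z) : unitary A) : A) := by
  induction m with
  | zero => exact ⟨0, by simp [monomial, phase_zero]⟩
  | succ m ih =>
    obtain ⟨a, ha⟩ := ih (fun k l => hW k.succ l.succ) (fun j => y j.succ) (fun j => z j.succ)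
    choose b hb using fun j : Fin m => hW 0 j.succ
    have h1 := phase_comm_zpow (phase_comm_symm (phase_comm_monomial_right hb fun j => y j.succ))
      (z 0)
    refine ⟨z 0 * -∑ j : Fin m, (y j.succ : ℝ) * b j + a, ?_⟩
    simp only [monomial_succ, Submonoid.coe_mul]
    rw [mul_assoc, ← mul_assoc _ ((W 0 ^ z 0 : unitary A) : A), h1, smul_mul_assoc, mul_smul_comm,
      mul_assoc _ _ ((monomial _ _ : unitary A) : A), ha, mul_smul_comm, mul_smul_comm, smul_smul,
      phase_add, ← mul_assoc, Pi.add_apply, zpow_add, Submonoid.coe_mul]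
    rfl

/-- Reordering collapses every word to one ordered monomial; this is why the monomials span the
quantum torus densely. -/
theorem exists_lift_eq_smul_monomial {W : Fin n → unitary A}
    (hW : ∀ k l, ∃ a : ℝ, (W k : A) * W l = phase a • ((W l : A) * W k)) (g : FreeGroup (Fin n)) :
    ∃ (a : ℝ) (z : Fin n → ℤ),
      (FreeGroup.lift W g : A) = phase a • ((monomial W z : unitary A) : A) := by
  induction g using FreeGroup.induction_on with
  | C1 => exact ⟨0, 0, by simp [phase_zero, monomial_zero]⟩
  | of k => exact ⟨0, Pi.single k 1, by simp [phase_zero, monomial_single]⟩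
  | inv_of k _ =>
    obtain ⟨a, ha⟩ := exists_monomial_mul hW (Pi.single k 1) (-Pi.single k 1)
    refine ⟨-a, -Pi.single k 1, ?_⟩
    rw [add_neg_cancel, monomial_zero, monomial_single] at ha
    have h1 : ((W k)⁻¹ : unitary A) * ((W k : A) * (monomial W (-Pi.single k 1) : unitary A)) =
        ((monomial W (-Pi.single k 1) : unitary A) : A) := by
      rw [← mul_assoc, ← Submonoid.coe_mul, inv_mul_cancel, Submonoid.coe_one, one_mul]
    rw [← h1, ha, mul_smul_comm, smul_smul, ← phase_add, neg_add_cancel, phase_zero, one_smul,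
      map_inv, FreeGroup.lift_apply_of, Submonoid.coe_one, mul_one]
  | mul x y hx hy =>
    obtain ⟨a, y, ha⟩ := hx
    obtain ⟨b, z, hb⟩ := hy
    obtain ⟨c, hc⟩ := exists_monomial_mul hW y z
    refine ⟨a + b + c, y + z, ?_⟩
    rw [map_mul, Submonoid.coe_mul, ha, hb, smul_mul_smul_comm, hc, smul_smul, phase_add, phase_add]

end Monomials

/-! ### The gauge action -/

section FourierProj

open MeasureTheory UnitAddTorus

theorem action_comm {n : ℕ} {A : Type*} [CStarAlgebra A]
    (β : Multiplicative (Fin n → ℝ) →* (A ≃⋆ₐ[ℂ] A)) (s t : Multiplicative (Fin n → ℝ)) (a : A) :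
    β s (β t a) = β t (β s a) := by
  change (β s * β t) a = (β t * β s) a
  rw [← map_mul, ← map_mul, mul_comm]

theorem IsPeriodic.of_continuous {n : ℕ} {A : Type*} [CStarAlgebra A]
    {β : Multiplicative (Fin n → ℝ) →* (A ≃⋆ₐ[ℂ] A)}
    (hc : Continuous fun p : Multiplicative (Fin n → ℝ) × A => β p.1 p.2)
    (hp : ∀ m : Fin n → ℤ, β (.ofAdd fun i => (m i : ℝ)) = 1) : IsPeriodic β where
  continuous _ := hc.comp (continuous_ofAdd.prodMk continuous_const)
  periodic := hp

local instance : MeasureSpace UnitAddCircle := ⟨AddCircle.haarAddCircle⟩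

local instance : Measure.IsAddHaarMeasure (volume : Measure UnitAddCircle) :=
  inferInstanceAs (Measure.IsAddHaarMeasure AddCircle.haarAddCircle)

local instance : IsProbabilityMeasure (volume : Measure UnitAddCircle) :=
  inferInstanceAs (IsProbabilityMeasure AddCircle.haarAddCircle)

namespace IsPeriodic

variable {n : ℕ} {A : Type*} [CStarAlgebra A]
  {β : Multiplicative (Fin n → ℝ) →* (A ≃⋆ₐ[ℂ] A)} (hβ : IsPeriodic β)

include hβ

/-- The Fourier coefficient as a continuous linear map. -/
def fourierProjL (m : Fin n → ℤ) : A →L[ℂ] A :=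
  LinearMap.mkContinuous
    { toFun := fourierProj β m
      map_add' := fun a b => by
        rw [fourierProj, fourierProj, fourierProj,
          ← integral_add (hβ.integrable_smul_torusOrbit a _) (hβ.integrable_smul_torusOrbit b _)]
        refine integral_congr_ae (.of_forall fun t => ?_)
        change _ • β _ (a + b) = _ • β _ a + _ • β _ b
        rw [map_add, smul_add]
      map_smul' := fun c a => by
        rw [fourierProj, fourierProj, ← integral_smul]
        refine integral_congr_ae (.of_forall fun t => ?_)
        change _ • β _ (c • a) = c • _ • β _ a
        rw [map_smul, smul_comm] } 1 fun a => by
    refine (norm_integral_le_of_norm_le_const (C := 1 * ‖a‖) (.of_forall fun t => ?_)).trans ?_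
    · rw [norm_smul, torusOrbit, StarAlgEquiv.norm_map]
      refine mul_le_mul_of_nonneg_right ?_ (norm_nonneg a)
      exact ((mFourier (-m)).norm_coe_le_norm t).trans mFourier_norm.le
    · simp

theorem fourierProjL_apply (m : Fin n → ℤ) (a : A) : hβ.fourierProjL m a = fourierProj β m a := rfl

omit hβ in
theorem fourierProj_zero_of_mem_spec {a : A} (ha : a ∈ spec β 0) : fourierProj β 0 a = a := by
  have h (t : UnitAddTorus (Fin n)) : torusOrbit β a t = a := by
    rw [torusOrbit, ha, zero_dotProduct, phase_zero, one_smul]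
  simp [fourierProj, h, mFourier_zero]

/-- The zeroth coefficient of `a` is invariant, yet it commutes with the action and so also scales
by the character `χ`. One parameter where `χ` is not `1` kills it; `χ` need not be integral. -/
theorem fourierProj_zero_eq_zero {χ : Fin n → ℝ} (hχ : χ ≠ 0) {a : A} (ha : a ∈ spec β χ) :
    fourierProj β 0 a = 0 := by
  obtain ⟨j, hj⟩ := Function.ne_iff.1 hχ
  obtain ⟨r, hr⟩ : ∃ r : ℝ, phase (χ j * r) ≠ 1 := by
    by_contra! h
    exact hj (eq_zero_of_phase_mul_eq_one h)
  have h1 := hβ.apply_fourierProj (τ := β (.ofAdd (Pi.single j r)))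
    (fun s a => action_comm β _ _ a) 0 a
  rw [hβ.fourierProj_mem_spec 0 a, ha, dotProduct_single, dotProduct_single,
    ← hβ.fourierProjL_apply, ← hβ.fourierProjL_apply, map_smul (hβ.fourierProjL 0),
    hβ.fourierProjL_apply] at h1
  rw [Pi.zero_apply, Int.cast_zero, zero_mul, phase_zero, one_smul, eq_comm, ← sub_eq_zero] at h1
  have h3 : (phase (χ j * r) - 1) • fourierProj β 0 a = 0 := by rw [sub_smul, one_smul, h1]
  exact (smul_eq_zero.1 h3).resolve_left (sub_ne_zero.2 hr)

/-- An action is ergodic if the algebra is topologically spanned by the unit and eigenvectors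
for nonzero characters. -/
theorem isErgodic_of_span_eq_top {X : Set A} (hX : (Submodule.span ℂ X).topologicalClosure = ⊤)
    (h : ∀ x ∈ X, x = 1 ∨ ∃ χ : Fin n → ℝ, χ ≠ 0 ∧ x ∈ spec β χ) : IsErgodic β := by
  rw [isErgodic_iff_mem_spec]
  intro a ha
  let S := Submodule.span ℂ {(1 : A)}
  have hcl : IsClosed (S : Set A) := Submodule.closed_of_finiteDimensional _
  -- Averaging sends every generator into the scalars, a closed subspace, and is the identity on
  -- fixed points.
  have h1 : (Submodule.span ℂ X).topologicalClosure ≤ S.comap (hβ.fourierProjL 0).toLinearMap := by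
    refine Submodule.topologicalClosure_minimal _ (Submodule.span_le.2 fun x hx => ?_)
      (hcl.preimage (hβ.fourierProjL 0).continuous)
    change fourierProj β 0 x ∈ S
    obtain rfl | ⟨χ, hχ, hxχ⟩ := h x hx
    · rw [fourierProj_zero_of_mem_spec one_mem_spec]
      exact Submodule.mem_span_singleton_self 1
    · rw [hβ.fourierProj_zero_eq_zero hχ hxχ]
      exact Submodule.zero_mem _
  have h2 : fourierProj β 0 a ∈ S := h1 (hX ▸ Submodule.mem_top)
  rw [fourierProj_zero_of_mem_spec ha, Submodule.mem_span_singleton] at h2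
  obtain ⟨c, rfl⟩ := h2
  exact ⟨c, (Algebra.algebraMap_eq_smul_one c).symm⟩

end IsPeriodic

end FourierProj

/-! ### Criteria for joint continuity and for injectivity. -/

/-- Automorphisms are isometric, so continuity of orbits on a dense subspace already gives joint
continuity. -/
theorem continuous_action_of_span_eq_top {n : ℕ} {A : Type*} [CStarAlgebra A]
    {β : Multiplicative (Fin n → ℝ) →* (A ≃⋆ₐ[ℂ] A)} {X : Set A}
    (hX : (Submodule.span ℂ X).topologicalClosure = ⊤)
    (h : ∀ x ∈ X, Continuous fun s : Multiplicative (Fin n → ℝ) => β s x) :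
    Continuous fun p : Multiplicative (Fin n → ℝ) × A => β p.1 p.2 := by
  have hc := continuous_prod_of_dense_continuous_lipschitzWith
    (fun p : A × Multiplicative (Fin n → ℝ) => β p.2 p.1) 1
    (Submodule.dense_iff_topologicalClosure_eq_top.2 hX) (fun a ha => by
      induction ha using Submodule.span_induction with
      | mem x hx => exact h x hx
      | zero => exact continuous_const.congr fun s => (map_zero (β s)).symm
      | add x y _ _ hx hy => exact (hx.add hy).congr fun s => (map_add (β s) x y).symm
      | smul c x _ hx => exact (hx.const_smul c).congr fun s => (map_smul (β s) c x).symm)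
    (fun s => (StarAlgEquiv.isometry (β s)).lipschitz)
  exact hc.comp continuous_swap

theorem continuous_phase_dotProduct {n : ℕ} (χ : Fin n → ℝ) :
    Continuous fun s : Fin n → ℝ => phase (χ ⬝ᵥ s) :=
  continuous_phase.comp (continuous_const.dotProduct continuous_id)

theorem continuous_orbit_of_mem_spec {n : ℕ} {A : Type*} [CStarAlgebra A]
    {β : Multiplicative (Fin n → ℝ) →* (A ≃⋆ₐ[ℂ] A)} {χ : Fin n → ℝ} {a : A}
    (ha : a ∈ spec β χ) : Continuous fun s : Multiplicative (Fin n → ℝ) => β s a :=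
  (((continuous_phase_dotProduct χ).comp continuous_toAdd).smul continuous_const).congr
    fun s => (ha s.toAdd).symm

theorem continuous_starAlgHom {A B : Type*} [CStarAlgebra A] [CStarAlgebra B]
    (ψ : A →⋆ₐ[ℂ] B) : Continuous ψ :=
  AddMonoidHomClass.continuous_of_bound ψ 1 fun x => by
    rw [one_mul]; exact NonUnitalStarAlgHom.norm_apply_le ψ x

theorem isClosed_range_of_injective {A B : Type*} [CStarAlgebra A] [CStarAlgebra B]
    {ψ : A →⋆ₐ[ℂ] B} (h : Function.Injective ψ) : IsClosed (Set.range ψ) :=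
  (NonUnitalStarAlgHom.isometry ψ h).isClosedEmbedding.isClosed_range

theorem ne_zero_of_unitary {A : Type*} [CStarAlgebra A] [Nontrivial A] (v : unitary A) :
    (v : A) ≠ 0 := fun h => by
  have h1 := CStarRing.norm_coe_unitary v
  rw [h, norm_zero] at h1
  exact zero_ne_one h1

/-- A homomorphism whose kernel is invariant under a periodic action is injective if it does not
kill eigenvectors. -/
theorem IsPeriodic.injective_of_ker_invariant {n : ℕ} {A B : Type*} [CStarAlgebra A]
    [CStarAlgebra B] {β : Multiplicative (Fin n → ℝ) →* (A ≃⋆ₐ[ℂ] A)} (hβ : IsPeriodic β)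
    (ψ : A →⋆ₐ[ℂ] B) (h : ∀ s x, ψ x = 0 → ψ (β (.ofAdd s) x) = 0)
    (h0 : ∀ (m : Fin n → ℤ) x, x ∈ spec β (fun i => (m i : ℝ)) → ψ x = 0 → x = 0) :
    Function.Injective ψ := by
  rw [injective_iff_map_eq_zero]
  intro x hx
  have h1 := hβ.mem_closure_span_fourierProj x
  have h2 : Submodule.span ℂ (Set.range fun m => fourierProj β m x) ≤ ⊥ := by
    rw [Submodule.span_le]
    rintro _ ⟨m, rfl⟩
    exact h0 m _ (hβ.fourierProj_mem_spec m x) (hβ.map_fourierProj_eq_zero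
      ⟨ψ.toAlgHom.toLinearMap, continuous_starAlgHom ψ⟩ x (fun s => h s x hx) m)
  exact Submodule.topologicalClosure_minimal _ h2 isClosed_singleton h1

/-! ### Continuity, ergodicity and faithfulness for the gauge action of the quantum torus. -/

namespace Torus

variable {n : ℕ} {θ : Matrix (Fin n) (Fin n) ℝ}

theorem u_mem_spec (k : Fin n) : (u θ k : Torus θ) ∈ spec (gauge θ) (Pi.single k 1) := fun s => by
  rw [gauge_u, single_dotProduct, one_mul]

theorem monomial_u_mem_spec (z : Fin n → ℤ) :
    ((monomial (u θ) z : unitary (Torus θ)) : Torus θ) ∈ spec (gauge θ) fun i => (z i : ℝ) := by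
  convert! monomial_mem_spec (W := u θ) u_mem_spec z
  simp [Finset.sum_apply, Pi.single_apply]

theorem mk_single (g : FreeGroup (Fin n)) (c : ℂ) :
    (mk (Pre.single g c) : Torus θ) = c • (FreeGroup.lift (u θ) g : Torus θ) := by
  have h : lift (u θ) isTuple_u = StarAlgHom.id ℂ (Torus θ) := hom_ext fun k => lift_u _ _ k
  rw [← preLift_single (θ := θ), ← lift_mk (u θ) isTuple_u, h]
  rfl

theorem span_monomial_topologicalClosure : (Submodule.span ℂ (Set.range fun z : Fin n → ℤ =>
    ((monomial (u θ) z : unitary (Torus θ)) : Torus θ))).topologicalClosure = ⊤ := by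
  rw [eq_top_iff]
  rintro x -
  induction x using induction with
  | hp => exact Submodule.isClosed_topologicalClosure _
  | ih a =>
    refine Submodule.le_topologicalClosure _ ?_
    induction a using Pre.induction_linear with
    | zero => rw [map_zero]; exact Submodule.zero_mem _
    | add x y hx hy => rw [map_add]; exact Submodule.add_mem _ hx hy
    | hsingle g c =>
      obtain ⟨a, z, ha⟩ := exists_lift_eq_smul_monomial (W := u θ)
        (fun k l => ⟨_, isTuple_u k l⟩) g
      rw [mk_single, ha]
      exact Submodule.smul_mem _ _ (Submodule.smul_mem _ _ (Submodule.subset_span ⟨z, rfl⟩))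

theorem continuous_gauge :
    Continuous fun p : Multiplicative (Fin n → ℝ) × Torus θ => gauge θ p.1 p.2 :=
  continuous_action_of_span_eq_top span_monomial_topologicalClosure <| by
    rintro _ ⟨z, rfl⟩
    exact continuous_orbit_of_mem_spec (monomial_u_mem_spec z)

theorem isPeriodic_gauge : IsPeriodic (gauge θ) :=
  .of_continuous continuous_gauge fun m => gauge_eq_one_of_mem θ ⟨m, rfl⟩

theorem isErgodic_gauge : IsErgodic (gauge θ) :=
  isPeriodic_gauge.isErgodic_of_span_eq_top span_monomial_topologicalClosure <| by
    rintro _ ⟨z, rfl⟩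
    by_cases hz : z = 0
    · left
      subst hz
      exact congrArg Subtype.val (monomial_zero (u θ))
    · right
      obtain ⟨j, hj⟩ := Function.ne_iff.1 hz
      exact ⟨_, Function.ne_iff.2 ⟨j, by simpa using hj⟩, monomial_u_mem_spec z⟩

/-- A representation of the quantum torus with gauge invariant kernel is faithful. -/
theorem injective_of_gauge_invariant_ker {B : Type*} [CStarAlgebra B] [Nontrivial B]
    (ψ : Torus θ →⋆ₐ[ℂ] B) (h : ∀ s x, ψ x = 0 → ψ (gauge θ (.ofAdd s) x) = 0) :
    Function.Injective ψ :=
  isPeriodic_gauge.injective_of_ker_invariant ψ h fun m x hx h0 => by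
    -- An eigenvector is a multiple of a monomial, and a unital map to a nonzero algebra cannot kill
    -- a unitary.
    obtain ⟨c, rfl⟩ := isErgodic_gauge.eq_smul (monomial_u_mem_spec m) hx
    rw [map_smul, smul_eq_zero] at h0
    rw [h0.resolve_right fun h2 => ?_, zero_smul]
    have h3 := congrArg ψ (Unitary.star_mul_self_of_mem (monomial (u θ) m).2)
    rw [map_mul, h2, mul_zero, map_one] at h3
    exact zero_ne_one h3

end Torus

/-! ### Freeness of actions with separating eigenunitaries -/

/-- The map induced by a homomorphism on unitary groups. -/
def unitaryMap {A B : Type*} [CStarAlgebra A] [CStarAlgebra B] (f : A →⋆ₐ[ℂ] B) :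
    unitary A →* unitary B where
  toFun v := ⟨f (v : A), Unitary.map_mem f v.2⟩
  map_one' := Subtype.ext (map_one f : f (1 : A) = 1)
  map_mul' v w := Subtype.ext (map_mul f (v : A) w)

section Free

variable {A : Type*} [CStarAlgebra A] {G : Type*} [Group G] {α : G →* (A ≃⋆ₐ[ℂ] A)}

theorem ellwoodMap_tmul (x y : A) (g : G) : ellwoodMap α (x ⊗ₜ y) g = x * α g y := rfl

/-- If `G` has eigenunitaries whose characters separate the points of `G`, then the image of the
Ellwood map contains functions with a prescribed value at one point and zeros elsewhere. -/
theorem exists_ellwoodMap_eq {J : Type*} {v : J → unitary A} {χ : J → G → ℂ}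
    (hv : ∀ j g, α g (v j : A) = χ j g • (v j : A))
    (hsep : ∀ g h, g ≠ h → ∃ j, χ j g ≠ χ j h) (g : G) (a : A) (S : Finset G) (hg : g ∉ S) :
    ∃ z, ellwoodMap α z g = a ∧ ∀ h ∈ S, ellwoodMap α z h = 0 := by
  classical
  induction S using Finset.induction_on with
  | empty => exact ⟨a ⊗ₜ 1, by rw [ellwoodMap_tmul, map_one, mul_one], by simp⟩
  | insert s S _ ih =>
    rw [Finset.mem_insert, not_or] at hg
    obtain ⟨z, hz, hzS⟩ := ih hg.2
    obtain ⟨j, hj⟩ := hsep g s hg.1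
    -- Inserting `star v ⊗ v` between the two legs multiplies the value at `h` by `χ j h`.
    -- Subtracting `χ j s` and normalising, as in Lagrange interpolation, gives zero at `s` and
    -- preserves the value at `g`.
    let L : A ⊗[ℂ] A →ₗ[ℂ] A ⊗[ℂ] A :=
      TensorProduct.map (LinearMap.mulRight ℂ (star (v j : A))) (LinearMap.mulLeft ℂ (v j : A))
    have hL (w : A ⊗[ℂ] A) (h : G) : ellwoodMap α (L w) h = χ j h • ellwoodMap α w h := by
      induction w using TensorProduct.induction_on with
      | zero => simp
      | add x y hx hy => simp only [map_add, Pi.add_apply, smul_add, hx, hy]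
      | tmul x y =>
        change ellwoodMap α ((x * star (v j : A)) ⊗ₜ ((v j : A) * y)) h = _
        rw [ellwoodMap_tmul, ellwoodMap_tmul, map_mul, hv, smul_mul_assoc, mul_smul_comm,
          mul_assoc, ← mul_assoc _ (v j : A), Unitary.star_mul_self_of_mem (v j).2, one_mul]
    refine ⟨(χ j g - χ j s)⁻¹ • (L z - χ j s • z), ?_, fun h hh => ?_⟩
    · rw [map_smul, map_sub, map_smul, Pi.smul_apply, Pi.sub_apply, Pi.smul_apply, hL, ← sub_smul,
        smul_smul, inv_mul_cancel₀ (sub_ne_zero.2 hj), one_smul, hz]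
    · rw [map_smul, map_sub, map_smul, Pi.smul_apply, Pi.sub_apply, Pi.smul_apply, hL, ← sub_smul]
      obtain rfl | hh := Finset.mem_insert.1 hh
      · rw [sub_self, zero_smul, smul_zero]
      · rw [hzS h hh, smul_zero, smul_zero]

theorem isFree_of_separating [Finite G] {J : Type*} {v : J → unitary A} {χ : J → G → ℂ}
    (hv : ∀ j g, α g (v j : A) = χ j g • (v j : A))
    (hsep : ∀ g h, g ≠ h → ∃ j, χ j g ≠ χ j h) : IsFree α := by
  classical
  have := Fintype.ofFinite G
  refine Function.Surjective.denseRange fun F => ?_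
  choose z hz hz0 using fun g => exists_ellwoodMap_eq hv hsep g (F g) (Finset.univ.erase g)
    (Finset.notMem_erase g _)
  refine ⟨∑ g, z g, funext fun h => ?_⟩
  rw [map_sum, Finset.sum_apply, Finset.sum_eq_single h, hz]
  · exact fun g _ hg => hz0 g h (Finset.mem_erase.2 ⟨Ne.symm hg, Finset.mem_univ _⟩)
  · simp

/-- If `α g = α g'`, all functions in the image of the Ellwood map agree at `g` and `g'`. This
closed condition fails for a function supported at `g`. -/
theorem IsFree.injective [Finite G] [Nontrivial A] (h : IsFree α) : Function.Injective α := by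
  classical
  intro g g' hgg
  by_contra hne
  have h1 : IsClosed {F : G → A | F g = F g'} :=
    isClosed_eq (continuous_apply g) (continuous_apply g')
  have h2 (z : A ⊗[ℂ] A) : ellwoodMap α z g = ellwoodMap α z g' := by
    induction z using TensorProduct.induction_on with
    | zero => simp
    | add x y hx hy => simp only [map_add, Pi.add_apply, hx, hy]
    | tmul x y => rw [ellwoodMap_tmul, ellwoodMap_tmul, hgg]
  have h3 := DenseRange.induction_on (p := fun F : G → A => F g = F g') h (Pi.single g 1) h1 h2
  simp [Pi.single_eq_of_ne (Ne.symm hne)] at h3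

end Free

/-! ### Lattices -/

section Lattice

variable {n : ℕ}

/-- An integer matrix viewed as a real matrix. -/
abbrev realMatrix (M : Matrix (Fin n) (Fin n) ℤ) : Matrix (Fin n) (Fin n) ℝ :=
  M.map (Int.cast : ℤ → ℝ)

theorem isUnit_det_realMatrix {M : Matrix (Fin n) (Fin n) ℤ} (hM : M.det ≠ 0) :
    IsUnit (realMatrix M).det := by
  have : (realMatrix M).det = (M.det : ℝ) := ((Int.castRingHom ℝ).map_det M).symm
  rw [this, isUnit_iff_ne_zero]
  exact_mod_cast hM

theorem mem_intLattice {s : Fin n → ℝ} : s ∈ intLattice n ↔ ∀ k, ∃ m : ℤ, s k = m := by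
  refine ⟨fun ⟨m, hm⟩ k => ⟨m k, by rw [hm]⟩, fun h => ?_⟩
  choose m hm using h
  exact ⟨m, funext hm⟩

theorem mem_invLattice {M : Matrix (Fin n) (Fin n) ℤ} (hM : M.det ≠ 0) {s : Fin n → ℝ} :
    s ∈ invLattice M ↔ realMatrix M *ᵥ s ∈ intLattice n := by
  constructor
  · rintro ⟨t, ht, rfl⟩
    change realMatrix M *ᵥ ((realMatrix M)⁻¹ *ᵥ t) ∈ _
    rwa [Matrix.mulVec_mulVec, Matrix.mul_nonsing_inv _ (isUnit_det_realMatrix hM),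
      Matrix.one_mulVec]
  · intro h
    refine ⟨_, h, ?_⟩
    change (realMatrix M)⁻¹ *ᵥ (realMatrix M *ᵥ s) = s
    rw [Matrix.mulVec_mulVec, Matrix.nonsing_inv_mul _ (isUnit_det_realMatrix hM),
      Matrix.one_mulVec]

end Lattice

/-! ### The model coverings -/

section Model

variable {n : ℕ} {θ θ' : Matrix (Fin n) (Fin n) ℝ} {M : Matrix (Fin n) (Fin n) ℤ}

theorem gauge_eq_one_iff (hθ' : θ'ᵀ = -θ') {s : Fin n → ℝ} :
    Torus.gauge θ' (.ofAdd s) = 1 ↔ s ∈ intLattice n := by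
  refine ⟨fun h => mem_intLattice.2 fun k => ?_, gauge_eq_one_of_mem θ'⟩
  have := Torus.nontrivial hθ'
  have h1 := Torus.gauge_u (θ := θ') s k
  rw [h] at h1
  have h2 : (1 - phase (s k)) • (Torus.u θ' k : Torus θ') = 0 := by
    rw [sub_smul, one_smul, sub_eq_zero]; exact h1
  rw [smul_eq_zero, or_iff_left (ne_zero_of_unitary _), sub_eq_zero] at h2
  exact (phase_eq_one_iff _).1 h2.symm

theorem deckAction_injective (hθ' : θ'ᵀ = -θ') : Function.Injective (deckAction M θ') := by
  rw [injective_iff_map_eq_one]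
  intro d hd
  obtain ⟨s, hs⟩ := QuotientAddGroup.mk_surjective d.toAdd
  have h1 : d = .ofAdd (QuotientAddGroup.mk s) := hs.symm
  rw [h1, deckAction_mk, gauge_eq_one_iff hθ'] at hd
  rw [h1, ← ofAdd_zero]
  congr 1
  exact (QuotientAddGroup.eq_zero_iff s).2 hd

theorem exists_deckAction_eq (d : DeckGroup M) :
    ∃ s ∈ invLattice M, deckAction M θ' d = Torus.gauge θ' (.ofAdd s) := by
  obtain ⟨s, hs⟩ := QuotientAddGroup.mk_surjective d.toAdd
  refine ⟨s.1, s.2, ?_⟩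
  rw [← deckAction_mk, hs]
  rfl

/-- The generators are eigenunitaries of the deck transformations, with separating characters. -/
theorem exists_separating_characters (hθ' : θ'ᵀ = -θ') (M : Matrix (Fin n) (Fin n) ℤ) :
    ∃ χ : Fin n → DeckGroup M → ℂ,
      (∀ j d, deckAction M θ' d (Torus.u θ' j : Torus θ') = χ j d • (Torus.u θ' j : Torus θ')) ∧
      ∀ d d', d ≠ d' → ∃ j, χ j d ≠ χ j d' := by
  choose s hs hd using fun d => exists_deckAction_eq (θ' := θ') (M := M) d
  refine ⟨fun j d => phase (s d j), fun j d => by rw [hd, Torus.gauge_u], fun d d' hdd => ?_⟩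
  by_contra! hc
  refine hdd (deckAction_injective hθ' ?_)
  rw [hd, hd]
  have h1 : Torus.gaugeHom θ' (s d) = Torus.gaugeHom θ' (s d') :=
    Torus.hom_ext fun k => by rw [Torus.gaugeHom_u, Torus.gaugeHom_u, hc k]
  ext x
  exact DFunLike.congr_fun h1 x

theorem modelGenerator_mem_spec (k : Fin n) :
    (modelGenerator M θ' k : Torus θ') ∈ spec (Torus.gauge θ') (realMatrix M k) :=
  Torus.monomial_u_mem_spec (M k)

theorem modelGenerator_comm (k l : Fin n) :
    (modelGenerator M θ' k : Torus θ') * modelGenerator M θ' l =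
      phase ((realMatrix M * θ' * (realMatrix M)ᵀ) k l) •
        ((modelGenerator M θ' l : Torus θ') * modelGenerator M θ' k) := by
  refine (phase_comm_monomial Torus.isTuple_u (M k) (M l)).trans ?_
  congr 2
  rw [Matrix.mul_assoc]
  rfl

theorem IsModelData.isTuple (h : IsModelData θ M θ') : IsTuple θ (modelGenerator M θ') := by
  intro k l
  obtain ⟨N, hN⟩ := h.rel
  rw [modelGenerator_comm, hN, Matrix.add_apply, phase_add]
  have : phase ((N.map (Int.cast : ℤ → ℝ)) k l) = 1 := phase_int _
  rw [this, mul_one]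

/-- The canonical embedding of the quantum torus of `θ` into that of `θ'`. -/
def modelHom (h : IsModelData θ M θ') : Torus θ →⋆ₐ[ℂ] Torus θ' :=
  Torus.lift (modelGenerator M θ') h.isTuple

theorem modelHom_u (h : IsModelData θ M θ') (k : Fin n) :
    modelHom h (Torus.u θ k : Torus θ) = modelGenerator M θ' k :=
  Torus.lift_u _ _ k

/-- The image of `u k` has row `k` of `M` as its character, so the parameter `s` upstairs
corresponds to `M s` downstairs. -/
theorem hom_gauge_of_modelGenerator {ι : Torus θ →⋆ₐ[ℂ] Torus θ'}
    (hι : ∀ k, ι (Torus.u θ k : Torus θ) = modelGenerator M θ' k) (s : Fin n → ℝ) (x : Torus θ) :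
    ι (Torus.gauge θ (.ofAdd (realMatrix M *ᵥ s)) x) = Torus.gauge θ' (.ofAdd s) (ι x) := by
  have h : ι.comp (Torus.gaugeHom θ (realMatrix M *ᵥ s)) = (Torus.gaugeHom θ' s).comp ι :=
    Torus.hom_ext fun k => by
      rw [StarAlgHom.comp_apply, StarAlgHom.comp_apply, Torus.gaugeHom_u, map_smul, hι]
      exact (modelGenerator_mem_spec k s).symm
  exact DFunLike.congr_fun h x

/-- Because `M` is invertible over `ℝ`, every gauge transformation downstairs comes from one
upstairs, so the kernel is gauge invariant. -/
theorem modelHom_injective (h : IsModelData θ M θ') : Function.Injective (modelHom h) := by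
  have := Torus.nontrivial h.skew
  refine Torus.injective_of_gauge_invariant_ker _ fun s x hx => ?_
  have h1 := hom_gauge_of_modelGenerator (modelHom_u h) ((realMatrix M)⁻¹ *ᵥ s) x
  rw [Matrix.mulVec_mulVec, Matrix.mul_nonsing_inv _ (isUnit_det_realMatrix h.det_ne_zero),
    Matrix.one_mulVec] at h1
  rw [h1, hx, map_zero]

/-- Lattice duality: pairing `m` with the columns of `M⁻¹` must give integers, and these are the
coordinates of `m` in the rows of `M`. -/
theorem exists_eq_vecMul_of_phase_eq_one (hM : M.det ≠ 0) {m : Fin n → ℤ}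
    (h : ∀ s ∈ invLattice M, phase ((fun i => (m i : ℝ)) ⬝ᵥ s) = 1) :
    ∃ z : Fin n → ℤ, (fun i => (m i : ℝ)) = (fun i => (z i : ℝ)) ᵥ* realMatrix M := by
  have h1 (k : Fin n) : ∃ z : ℤ, ((fun i => (m i : ℝ)) ᵥ* (realMatrix M)⁻¹) k = z := by
    have h2 := h ((realMatrix M)⁻¹ *ᵥ Pi.single k 1)
      ⟨_, mem_intLattice.2 fun j => ⟨(Pi.single k 1 : Fin n → ℤ) j, by
        by_cases hj : j = k <;> simp [hj]⟩, rfl⟩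
    rw [Matrix.dotProduct_mulVec, dotProduct_single, mul_one] at h2
    exact (phase_eq_one_iff _).1 h2
  choose z hz using h1
  refine ⟨z, ?_⟩
  rw [← funext hz]
  rw [Matrix.vecMul_vecMul, Matrix.nonsing_inv_mul _ (isUnit_det_realMatrix hM), Matrix.vecMul_one]

theorem modelHom_mem_fixed (h : IsModelData θ M θ') (x : Torus θ) (d : DeckGroup M) :
    deckAction M θ' d (modelHom h x) = modelHom h x := by
  obtain ⟨s, hs, hd⟩ := exists_deckAction_eq (θ' := θ') d
  rw [hd, ← hom_gauge_of_modelGenerator (modelHom_u h),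
    gauge_eq_one_of_mem θ ((mem_invLattice h.det_ne_zero).1 hs)]
  rfl

/-- A nonzero Fourier coefficient of a fixed element has a character trivial on `M⁻¹ ℤⁿ`, hence in
the row lattice of `M`. There the spectral line is spanned by a monomial in the model generators,
and the range is closed. -/
theorem mem_range_modelHom (h : IsModelData θ M θ') {x : Torus θ'}
    (hx : ∀ d, deckAction M θ' d x = x) : x ∈ Set.range (modelHom h) := by
  have h1 := Torus.isPeriodic_gauge.mem_closure_span_fourierProj x
  have hx' (s : Fin n → ℝ) (hs : s ∈ invLattice M) : Torus.gauge θ' (.ofAdd s) x = x := by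
    rw [← deckAction_mk M θ' ⟨s, hs⟩, hx]
  have h2 : Submodule.span ℂ (Set.range fun m => fourierProj (Torus.gauge θ') m x) ≤
      LinearMap.range (modelHom h).toAlgHom.toLinearMap := by
    rw [Submodule.span_le]
    rintro _ ⟨m, rfl⟩
    change fourierProj (Torus.gauge θ') m x ∈ LinearMap.range (modelHom h).toAlgHom.toLinearMap
    by_cases h0 : fourierProj (Torus.gauge θ') m x = 0
    · rw [h0]
      exact Submodule.zero_mem _
    have h3 := Torus.isPeriodic_gauge.fourierProj_mem_spec m x
    obtain ⟨z, hz⟩ := exists_eq_vecMul_of_phase_eq_one h.det_ne_zero (m := m) fun s hs => by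
      have h4 := Torus.isPeriodic_gauge.apply_fourierProj
        (τ := Torus.gauge θ' (.ofAdd s)) (fun t a => action_comm _ _ _ a) m x
      rw [hx' s hs, h3, ← sub_eq_zero] at h4
      have h5 : (phase ((fun i => (m i : ℝ)) ⬝ᵥ s) - 1) • fourierProj (Torus.gauge θ') m x = 0 := by
        rw [sub_smul, one_smul, h4]
      exact sub_eq_zero.1 ((smul_eq_zero.1 h5).resolve_right h0)
    have h6 := monomial_mem_spec (W := modelGenerator M θ') modelGenerator_mem_spec z
    rw [hz, Matrix.vecMul_eq_sum] at h3
    obtain ⟨c, hc⟩ := Torus.isErgodic_gauge.eq_smul h6 h3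
    rw [hc]
    refine Submodule.smul_mem _ _ ⟨(monomial (Torus.u θ) z : unitary (Torus θ)), ?_⟩
    have h7 := map_monomial (unitaryMap (modelHom h)) (Torus.u θ) z
    have h8 : (fun j => (unitaryMap (modelHom h)) (Torus.u θ j)) =
        modelGenerator M θ' := funext fun k => Subtype.ext (modelHom_u h k)
    rw [h8] at h7
    exact congrArg Subtype.val h7
  exact Submodule.topologicalClosure_minimal _ h2
    (isClosed_range_of_injective (modelHom_injective h)) h1

/-- The compact parallelepiped `M [0,1]ⁿ` meets every coset of `M ℤⁿ`. -/
theorem compactSpace_quotient_of_mem {K : Subgroup (Multiplicative (Fin n → ℝ))}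
    (hM : M.det ≠ 0) (hK : ∀ m ∈ intLattice n, Multiplicative.ofAdd (realMatrix M *ᵥ m) ∈ K) :
    CompactSpace (Multiplicative (Fin n → ℝ) ⧸ K) := by
  let f : (Fin n → ℝ) → Multiplicative (Fin n → ℝ) ⧸ K :=
    fun r => QuotientGroup.mk (Multiplicative.ofAdd (realMatrix M *ᵥ r))
  have hf : Continuous f := continuous_quotient_mk'.comp
    (continuous_ofAdd.comp (Continuous.matrix_mulVec continuous_const continuous_id))
  have h1 : f '' Set.Icc 0 1 = Set.univ := by
    rw [Set.eq_univ_iff_forall]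
    intro q
    obtain ⟨s, rfl⟩ := QuotientGroup.mk_surjective q
    let t := (realMatrix M)⁻¹ *ᵥ s.toAdd
    refine ⟨fun i => Int.fract (t i), ⟨fun i => Int.fract_nonneg _, fun i => (Int.fract_lt_one _).le⟩,
      ?_⟩
    refine QuotientGroup.eq.2 ?_
    convert! hK (fun i => (⌊t i⌋ : ℝ)) ⟨_, rfl⟩
    apply Multiplicative.toAdd.injective
    have h2 : s.toAdd = realMatrix M *ᵥ t := by
      rw [Matrix.mulVec_mulVec, Matrix.mul_nonsing_inv _ (isUnit_det_realMatrix hM),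
        Matrix.one_mulVec]
    have h3 : t = (fun i => Int.fract (t i)) + fun i => (⌊t i⌋ : ℝ) :=
      funext fun i => (Int.fract_add_floor (t i)).symm
    rw [toAdd_mul, toAdd_inv, toAdd_ofAdd, toAdd_ofAdd, h2, neg_add_eq_iff_eq_add,
      ← Matrix.mulVec_add, ← h3]
  exact ⟨h1 ▸ isCompact_Icc.image hf⟩

section Transport

variable {A : Type*} [CStarAlgebra A] {G : Type*} [Group G] {α : G →* (A ≃⋆ₐ[ℂ] A)}
  {Φ : A ≃⋆ₐ[ℂ] Torus θ'} {φ : G ≃* DeckGroup M}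

theorem isCovering_of_isEquivalence [Finite G] (h : IsModelData θ M θ')
    (he : IsEquivalence α (deckAction M θ') Φ φ) :
    IsCovering α ((Φ.symm : Torus θ' →⋆ₐ[ℂ] A).comp (modelHom h)) where
  free := by
    obtain ⟨χ, hχ, hsep⟩ := exists_separating_characters h.skew M
    -- The canonical generators, pulled back to `A`, are the separating eigenunitaries.
    refine isFree_of_separating (J := Fin n)
      (v := fun j => unitaryMap (Φ.symm : Torus θ' →⋆ₐ[ℂ] A) (Torus.u θ' j))
      (χ := fun j g => χ j (φ g)) (fun j g => ?_) (fun g g' hg => hsep _ _ (φ.injective.ne hg))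
    refine EquivLike.injective Φ ?_
    change Φ (α g (Φ.symm (Torus.u θ' j : Torus θ'))) =
      Φ (χ j (φ g) • Φ.symm (Torus.u θ' j : Torus θ'))
    rw [he, map_smul, StarAlgEquiv.apply_symm_apply, hχ]
  injective := Φ.symm.injective.comp (modelHom_injective h)
  range_eq := by
    ext a
    constructor
    · rintro ⟨x, rfl⟩ g
      refine EquivLike.injective Φ ?_
      rw [he]
      change deckAction M θ' (φ g) (Φ (Φ.symm (modelHom h x))) = Φ (Φ.symm (modelHom h x))
      rw [StarAlgEquiv.apply_symm_apply, modelHom_mem_fixed]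
    · intro ha
      obtain ⟨x, hx⟩ := mem_range_modelHom h (x := Φ a) fun d => by
        obtain ⟨g, rfl⟩ := φ.surjective d
        rw [← he, ha g]
      refine ⟨x, ?_⟩
      change Φ.symm (modelHom h x) = a
      rw [hx, StarAlgEquiv.symm_apply_apply]

theorem continuous_conjugate_action {H : Type*} [TopologicalSpace H] {B : Type*} [CStarAlgebra B]
    {γ : H → (B ≃⋆ₐ[ℂ] B)} (hγ : Continuous fun p : H × B => γ p.1 p.2) (Φ : A ≃⋆ₐ[ℂ] B)
    {f : H → H} (hf : Continuous f) :
    Continuous fun p : H × A => Φ.symm (γ (f p.1) (Φ p.2)) :=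
  (StarAlgEquiv.isometry Φ.symm).continuous.comp <| hγ.comp <|
    (hf.comp continuous_fst).prodMk ((StarAlgEquiv.isometry Φ).continuous.comp continuous_snd)

/-- An action of `ℝⁿ`, reparametrised by a matrix and transported along an isomorphism. -/
def transportedAction {B : Type*} [CStarAlgebra B]
    (γ : Multiplicative (Fin n → ℝ) →* (B ≃⋆ₐ[ℂ] B)) (P : Matrix (Fin n) (Fin n) ℝ)
    (Φ : A ≃⋆ₐ[ℂ] B) : Multiplicative (Fin n → ℝ) →* (A ≃⋆ₐ[ℂ] A) where
  toFun s := Φ.trans ((γ (.ofAdd (P *ᵥ s.toAdd))).trans Φ.symm)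
  map_one' := by
    ext a
    simp
  map_mul' s t := by
    ext a
    simp [Matrix.mulVec_add, ofAdd_add, map_mul]

theorem apply_transportedAction {B : Type*} [CStarAlgebra B]
    (γ : Multiplicative (Fin n → ℝ) →* (B ≃⋆ₐ[ℂ] B)) (P : Matrix (Fin n) (Fin n) ℝ)
    (Φ : A ≃⋆ₐ[ℂ] B) (s : Fin n → ℝ) (a : A) :
    Φ (transportedAction γ P Φ (.ofAdd s) a) = γ (.ofAdd (P *ᵥ s)) (Φ a) :=
  Φ.apply_symm_apply _

theorem continuous_transportedAction {B : Type*} [CStarAlgebra B]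
    {γ : Multiplicative (Fin n → ℝ) →* (B ≃⋆ₐ[ℂ] B)}
    (hγ : Continuous fun p : Multiplicative (Fin n → ℝ) × B => γ p.1 p.2)
    (P : Matrix (Fin n) (Fin n) ℝ) (Φ : A ≃⋆ₐ[ℂ] B) :
    Continuous fun p : Multiplicative (Fin n → ℝ) × A => transportedAction γ P Φ p.1 p.2 :=
  continuous_conjugate_action hγ Φ
    (f := fun s => Multiplicative.ofAdd (P *ᵥ s.toAdd)) (continuous_ofAdd.comp
      (Continuous.matrix_mulVec continuous_const continuous_toAdd))

theorem isConnectedCovering_of_isEquivalence (h : IsModelData θ M θ')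
    (he : IsEquivalence α (deckAction M θ') Φ φ) {ι : Torus θ →⋆ₐ[ℂ] A}
    (hι : ∀ k, Φ (ι (Torus.u θ k : Torus θ)) = modelGenerator M θ' k) :
    IsConnectedCovering α ι := by
  have hM := isUnit_det_realMatrix h.det_ne_zero
  -- The factor `M⁻¹` compensates for the `M` in `hom_gauge_of_modelGenerator`; the kernel then
  -- contains `M ℤⁿ`.
  refine ⟨transportedAction (Torus.gauge θ') (realMatrix M)⁻¹ Φ, ⟨?_, ?_, ?_⟩, ?_, ?_⟩
  · exact continuous_transportedAction Torus.continuous_gauge _ Φ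
  · refine compactSpace_quotient_of_mem h.det_ne_zero fun m hm => ?_
    rw [MonoidHom.mem_ker]
    ext a
    refine EquivLike.injective Φ ?_
    rw [apply_transportedAction, Matrix.mulVec_mulVec, Matrix.nonsing_inv_mul _ hM,
      Matrix.one_mulVec, gauge_eq_one_of_mem θ' hm]
    rfl
  · intro s x
    refine EquivLike.injective Φ ?_
    have h1 := hom_gauge_of_modelGenerator (ι := (Φ : A →⋆ₐ[ℂ] Torus θ').comp ι) hι
      ((realMatrix M)⁻¹ *ᵥ s.toAdd) x
    rw [Matrix.mulVec_mulVec, Matrix.mul_nonsing_inv _ hM, Matrix.one_mulVec] at h1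
    exact (apply_transportedAction _ _ Φ s.toAdd (ι x)).trans h1.symm
  · intro a ha
    obtain ⟨c, hc⟩ := Torus.isErgodic_gauge (θ := θ') (Φ a) fun s => by
      have h1 := apply_transportedAction (Torus.gauge θ') (realMatrix M)⁻¹ Φ (realMatrix M *ᵥ s.toAdd) a
      rw [ha, Matrix.mulVec_mulVec, Matrix.nonsing_inv_mul _ hM, Matrix.one_mulVec] at h1
      exact h1.symm
    refine ⟨c, EquivLike.injective Φ ?_⟩
    rw [hc, AlgHomClass.commutes Φ c]
  · intro g s a
    obtain ⟨t, -, ht⟩ := exists_deckAction_eq (θ' := θ') (φ g)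
    refine EquivLike.injective Φ ?_
    rw [he]
    change _ = Φ (transportedAction (Torus.gauge θ') (realMatrix M)⁻¹ Φ (.ofAdd s.toAdd) _)
    rw [apply_transportedAction, he, ht, action_comm]
    congr 1
    exact apply_transportedAction _ _ Φ s.toAdd a

end Transport

end Model

/-! ### Cocompact subgroups of `ℤⁿ` -/

section Cocompact

variable {n : ℕ}

/-- Images of balls about `0` form a directed open cover of the compact quotient, so a single ball
suffices. -/
theorem exists_norm_lt_of_compactSpace_quotient (K : Subgroup (Multiplicative (Fin n → ℝ)))
    [CompactSpace (Multiplicative (Fin n → ℝ) ⧸ K)] :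
    ∃ R : ℝ, ∀ s : Fin n → ℝ, ∃ t : Fin n → ℝ, .ofAdd t ∈ K ∧ ‖s - t‖ < R := by
  let f : (Fin n → ℝ) → Multiplicative (Fin n → ℝ) ⧸ K := fun s => QuotientGroup.mk (.ofAdd s)
  have hf : IsOpenMap f := QuotientGroup.isOpenMap_coe.comp isOpenMap_ofAdd
  obtain ⟨R, hR⟩ := (isCompact_univ (X := Multiplicative (Fin n → ℝ) ⧸ K)).elim_directed_cover
    (fun R : ℝ => f '' Metric.ball 0 R) (fun R => hf _ Metric.isOpen_ball)
    (fun q _ => by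
      obtain ⟨s, rfl⟩ := QuotientGroup.mk_surjective q
      refine Set.mem_iUnion.2 ⟨‖s.toAdd‖ + 1, s.toAdd, ?_, rfl⟩
      rw [mem_ball_zero_iff]
      exact lt_add_one ‖s.toAdd‖)
    (Monotone.directed_le fun R R' h => Set.image_mono (Metric.ball_subset_ball h))
  refine ⟨R, fun s => ?_⟩
  obtain ⟨r, hr, hrs⟩ := hR (Set.mem_univ (f s))
  refine ⟨s - r, ?_, ?_⟩
  · have h1 := QuotientGroup.eq.1 hrs
    rw [sub_eq_neg_add]
    exact h1
  · rw [sub_sub_cancel]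
    exact mem_ball_zero_iff.1 hr

/-- Pigeonhole: each multiple `j m` lies within `R` of a point of `K`, which is integral. The
differences are integer vectors in a finite box, so two coincide and the corresponding multiple of
`m` lies in `K`. -/
theorem exists_pos_smul_mem (K : Subgroup (Multiplicative (Fin n → ℝ)))
    [CompactSpace (Multiplicative (Fin n → ℝ) ⧸ K)]
    (hK : ∀ s : Fin n → ℝ, .ofAdd s ∈ K → s ∈ intLattice n) (m : Fin n → ℤ) :
    ∃ N : ℕ, 0 < N ∧ Multiplicative.ofAdd (fun i => (N : ℝ) * (m i : ℝ)) ∈ K := by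
  obtain ⟨R, hR⟩ := exists_norm_lt_of_compactSpace_quotient K
  choose t ht htR using fun j : ℕ => hR (fun i => (j : ℝ) * (m i : ℝ))
  choose z hz using fun j => hK _ (ht j)
  let S : Set (Fin n → ℤ) := Set.Icc (fun _ => -⌈R⌉) (fun _ => ⌈R⌉)
  have hS : S.Finite := Set.finite_Icc _ _
  have hmem (j : ℕ) : (fun i => (j : ℤ) * m i - z j i) ∈ S := by
    have h1 (i : Fin n) : |(((j : ℤ) * m i - z j i : ℤ) : ℝ)| ≤ ⌈R⌉ := by
      have h2 := norm_le_pi_norm ((fun i => (j : ℝ) * (m i : ℝ)) - t j) i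
      rw [Pi.sub_apply, hz, Real.norm_eq_abs] at h2
      push_cast
      have h3 := htR j
      rw [hz] at h3
      exact h2.trans (h3.le.trans (Int.le_ceil R))
    exact ⟨fun i => by have := (abs_le.1 (h1 i)).1; exact_mod_cast this,
      fun i => by have := (abs_le.1 (h1 i)).2; exact_mod_cast this⟩
  have := hS.to_subtype
  obtain ⟨i, j, hij, heq⟩ := Finite.exists_ne_map_eq_of_infinite (fun j : ℕ => (⟨_, hmem j⟩ : S))
  wlog hlt : i < j generalizing i j
  · exact this j i hij.symm heq.symm (lt_of_le_of_ne (not_lt.1 hlt) hij.symm)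
  refine ⟨j - i, Nat.sub_pos_of_lt hlt, ?_⟩
  have h1 : (fun k => ((j - i : ℕ) : ℝ) * (m k : ℝ)) = t j - t i := by
    ext k
    have h2 := congrFun (Subtype.ext_iff.1 heq) k
    simp only at h2
    have h3 : ((i : ℝ) * m k - z i k) = (j : ℝ) * m k - z j k := by exact_mod_cast h2
    rw [Pi.sub_apply, hz, hz, Nat.cast_sub hlt.le]
    linarith
  rw [h1, ofAdd_sub]
  exact K.div_mem (ht j) (ht i)

theorem exists_pos_forall_smul_mem (K : Subgroup (Multiplicative (Fin n → ℝ)))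
    [CompactSpace (Multiplicative (Fin n → ℝ) ⧸ K)]
    (hK : ∀ s : Fin n → ℝ, .ofAdd s ∈ K → s ∈ intLattice n) :
    ∃ N : ℕ, 0 < N ∧ ∀ m : Fin n → ℤ, Multiplicative.ofAdd ((N : ℝ) • fun i => (m i : ℝ)) ∈ K := by
  choose N hN hNK using fun k : Fin n => exists_pos_smul_mem K hK (Pi.single k 1)
  -- The product is a common multiple of the periods along the coordinate axes.
  refine ⟨∏ k, N k, Finset.prod_pos fun k _ => hN k, fun m => ?_⟩
  have h1 : ((∏ k, N k : ℕ) : ℝ) • (fun i => (m i : ℝ)) = ∑ k, (m k * ∏ l ∈ Finset.univ.erase k, (N l : ℤ)) •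
      fun i => (N k : ℝ) * ((Pi.single k 1 : Fin n → ℤ) i : ℝ) := by
    ext i
    rw [Finset.sum_apply, Finset.sum_eq_single i]
    · simp only [Pi.smul_apply, smul_eq_mul, Pi.single_eq_same, zsmul_eq_mul]
      rw [← Finset.mul_prod_erase Finset.univ N (Finset.mem_univ i)]
      push_cast
      ring
    · intro k _ hk
      simp [Pi.single_eq_of_ne (Ne.symm hk)]
    · simp
  rw [h1, ofAdd_sum]
  exact K.prod_mem fun k _ => by
    rw [ofAdd_zsmul]
    exact K.zpow_mem (hNK k) _

/-- A subgroup of `ℤⁿ` containing `N ℤⁿ` with `N ≠ 0` is free of rank `n`. -/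
theorem nonempty_addEquiv_of_smul_mem (H : AddSubgroup (Fin n → ℤ)) {N : ℕ} (hN : 0 < N)
    (h : ∀ m : Fin n → ℤ, (N : ℤ) • m ∈ H) : Nonempty (H ≃+ (Fin n → ℤ)) := by
  -- For subgroups of `ℤⁿ`, full rank is the same as finite index, and `H` contains the kernel of
  -- reduction modulo `N`.
  rw [← Int.addSubgroup_index_ne_zero_iff]
  have : NeZero N := ⟨hN.ne'⟩
  let f : (Fin n → ℤ) →+ (Fin n → ZMod N) := (Int.castAddHom (ZMod N)).compLeft (Fin n)
  have hle : f.ker ≤ H := fun x hx => by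
    have h1 (i : Fin n) : ∃ y : ℤ, x i = N * y :=
      (ZMod.intCast_zmod_eq_zero_iff_dvd (x i) N).1 (congrFun hx i)
    choose y hy using h1
    convert! h y
    ext i
    exact hy i
  have := AddSubgroup.finiteIndex_of_le hle
  exact AddSubgroup.FiniteIndex.index_ne_zero

end Cocompact

/-! ### The structure of connected coverings -/

section Structure

variable {n : ℕ} {A : Type*} [CStarAlgebra A]

/-- The action `s ↦ β (r s)`. -/
def rescale (β : Multiplicative (Fin n → ℝ) →* (A ≃⋆ₐ[ℂ] A)) (r : ℝ) :
    Multiplicative (Fin n → ℝ) →* (A ≃⋆ₐ[ℂ] A) :=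
  β.comp (AddMonoidHom.toMultiplicative (DistribSMul.toAddMonoidHom (Fin n → ℝ) r))

variable {β : Multiplicative (Fin n → ℝ) →* (A ≃⋆ₐ[ℂ] A)}

theorem rescale_ofAdd (r : ℝ) (s : Fin n → ℝ) : rescale β r (.ofAdd s) = β (.ofAdd (r • s)) := rfl

theorem mem_spec_of_mem_spec_rescale {r : ℝ} (hr : r ≠ 0) {χ : Fin n → ℝ} {a : A}
    (ha : a ∈ spec (rescale β r) χ) : a ∈ spec β (r⁻¹ • χ) := fun s => by
  have h1 := ha (r⁻¹ • s)
  rw [rescale_ofAdd, smul_smul, mul_inv_cancel₀ hr, one_smul] at h1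
  rw [h1, smul_dotProduct, dotProduct_smul]

/-- An ergodic action that is trivial on `N ℤⁿ` and has the integral characters in its spectrum is
spanned by monomials in eigenunitaries for the rows of the inverse of an integer matrix. -/
theorem exists_eigenunitaries (he : IsErgodic β)
    (hc : Continuous fun p : Multiplicative (Fin n → ℝ) × A => β p.1 p.2) {N : ℕ} (hN : 0 < N)
    (hper : ∀ m : Fin n → ℤ, β (.ofAdd ((N : ℝ) • fun i => (m i : ℝ))) = 1)
    {w : Fin n → unitary A} (hw : ∀ k, (w k : A) ∈ spec β (Pi.single k 1)) :
    ∃ (M : Matrix (Fin n) (Fin n) ℤ) (W : Fin n → unitary A), M.det ≠ 0 ∧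
      (∀ j, (W j : A) ∈ spec β ((realMatrix M)⁻¹ j)) ∧
      (Submodule.span ℂ (Set.range fun z : Fin n → ℤ =>
        ((monomial W z : unitary A) : A))).topologicalClosure = ⊤ := by
  have hN' : (N : ℝ) ≠ 0 := by exact_mod_cast hN.ne'
  -- This is the spectrum of `β` scaled by `N`. Witnessing it by unitaries makes it visibly a group;
  -- monomials in `w` show that it contains `N ℤⁿ`.
  let H : AddSubgroup (Fin n → ℤ) :=
    { carrier := {m | ∃ v : unitary A, (v : A) ∈ spec β ((N : ℝ)⁻¹ • fun i => (m i : ℝ))}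
      zero_mem' := ⟨1, by
        have h1 : (N : ℝ)⁻¹ • (fun i => (((0 : Fin n → ℤ) i : ℤ) : ℝ)) = 0 := by ext; simp
        rw [h1]
        exact one_mem_spec⟩
      add_mem' := by
        rintro m m' ⟨v, hv⟩ ⟨v', hv'⟩
        refine ⟨v * v', ?_⟩
        have h1 : (N : ℝ)⁻¹ • (fun i => (((m + m') i : ℤ) : ℝ)) =
            (N : ℝ)⁻¹ • (fun i => (m i : ℝ)) + (N : ℝ)⁻¹ • fun i => (m' i : ℝ) := by
          ext; simp [mul_add]
        rw [h1]
        exact mul_mem_spec hv hv'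
      neg_mem' := by
        rintro m ⟨v, hv⟩
        refine ⟨v⁻¹, ?_⟩
        have h1 : (N : ℝ)⁻¹ • (fun i => (((-m) i : ℤ) : ℝ)) =
            -((N : ℝ)⁻¹ • fun i => (m i : ℝ)) := by
          ext; simp
        rw [h1]
        exact unitary_inv_mem_spec hv }
  have hH (m : Fin n → ℤ) : (N : ℤ) • m ∈ H := by
    refine ⟨monomial w m, ?_⟩
    convert! monomial_mem_spec hw m
    ext
    simp [Finset.sum_apply, Pi.single_apply, hN']
  obtain ⟨e⟩ := nonempty_addEquiv_of_smul_mem H hN hH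
  let b : Fin n → H := fun j => e.symm (Pi.single j 1)
  have hb (x : H) : (x : Fin n → ℤ) = ∑ j, e x j • (b j : Fin n → ℤ) := by
    have h1 : x = ∑ j, e x j • b j := by
      apply e.injective
      rw [map_sum]
      simp only [map_zsmul, b, e.apply_symm_apply]
      ext i
      simp [Finset.sum_apply, Pi.single_apply]
    conv_lhs => rw [h1]
    simp
  choose W hW using fun j => (b j).2
  -- Row `k` of `M` holds the coordinates of `N e_k` in the basis `b`, and row `j` of `P` is `b j /
  -- N`, the character of `W j`; hence `M P = 1`.
  let M : Matrix (Fin n) (Fin n) ℤ := Matrix.of fun k => e ⟨_, hH (Pi.single k 1)⟩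
  let P : Matrix (Fin n) (Fin n) ℝ := Matrix.of fun j i => (N : ℝ)⁻¹ * ((b j : Fin n → ℤ) i : ℝ)
  have hMP : realMatrix M * P = 1 := by
    ext k i
    have h1 := congrFun (hb ⟨_, hH (Pi.single k 1)⟩) i
    simp only [Finset.sum_apply, Pi.smul_apply, smul_eq_mul] at h1
    have h2 : (N : ℝ) * ((Pi.single k 1 : Fin n → ℤ) i : ℝ) =
        ∑ j, (M k j : ℝ) * ((b j : Fin n → ℤ) i : ℝ) := by
      exact_mod_cast h1
    rw [Matrix.mul_apply]
    simp only [Matrix.map_apply, P, Matrix.of_apply, mul_left_comm _ (N : ℝ)⁻¹]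
    rw [← Finset.mul_sum, ← h2, ← mul_assoc, inv_mul_cancel₀ hN', one_mul, Matrix.one_apply,
      Pi.single_apply]
    simp only [eq_comm]
    split_ifs <;> simp
  have hdet : M.det ≠ 0 := fun h0 => by
    have h1 := congrArg Matrix.det hMP
    have h2 : (realMatrix M).det = (M.det : ℝ) := ((Int.castRingHom ℝ).map_det M).symm
    rw [Matrix.det_mul, h2, h0, Int.cast_zero, zero_mul, Matrix.det_one] at h1
    exact zero_ne_one h1
  have hP : (realMatrix M)⁻¹ = P := Matrix.inv_eq_right_inv hMP
  have hW' (j : Fin n) : (W j : A) ∈ spec β (P j) := hW j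
  refine ⟨M, W, hdet, fun j => hP ▸ hW' j, ?_⟩
  -- The rescaled action has period `ℤⁿ`, so Fourier analysis applies; its coefficient at `m` has
  -- character `m / N` under `β`.
  have hβ : IsPeriodic (rescale β N) :=
    { continuous := fun a => hc.comp ((continuous_ofAdd.comp
        (continuous_const_smul (N : ℝ))).prodMk continuous_const)
      periodic := hper }
  rw [eq_top_iff]
  rintro a -
  refine Submodule.topologicalClosure_mono ?_ (hβ.mem_closure_span_fourierProj a)
  rw [Submodule.span_le]
  rintro _ ⟨m, rfl⟩
  have h1 := mem_spec_of_mem_spec_rescale hN' (hβ.fourierProj_mem_spec m a)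
  by_cases h0 : fourierProj (rescale β N) m a = 0
  · change fourierProj (rescale β N) m a ∈ Submodule.span ℂ _
    rw [h0]
    exact Submodule.zero_mem _
  have hm : m ∈ H := he.exists_unitary h1 h0
  have h2 := monomial_mem_spec hW' (e ⟨m, hm⟩)
  have h3 : ∑ j, (e ⟨m, hm⟩ j : ℝ) • P j = (N : ℝ)⁻¹ • fun i => (m i : ℝ) := by
    ext i
    have h4 := congrFun (hb ⟨m, hm⟩) i
    simp only [Finset.sum_apply, Pi.smul_apply, smul_eq_mul] at h4
    have h5 : (m i : ℝ) = ∑ j, (e ⟨m, hm⟩ j : ℝ) * ((b j : Fin n → ℤ) i : ℝ) := by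
      exact_mod_cast h4
    simp only [Finset.sum_apply, Pi.smul_apply, smul_eq_mul, P, Matrix.of_apply,
      mul_left_comm _ (N : ℝ)⁻¹]
    rw [← Finset.mul_sum, ← h5]
  rw [h3] at h2
  obtain ⟨c, hc⟩ := he.eq_smul h2 h1
  change fourierProj (rescale β N) m a ∈ Submodule.span ℂ _
  rw [hc]
  exact Submodule.smul_mem _ _ (Submodule.subset_span ⟨_, rfl⟩)

/-- Unitaries commuting up to phases satisfy the relations of a skew-symmetric matrix. -/
theorem exists_skew_isTuple {W : Fin n → unitary A}
    (hW : ∀ j l, ∃ t : ℝ, (W j : A) * W l = phase t • ((W l : A) * W j)) :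
    ∃ θ' : Matrix (Fin n) (Fin n) ℝ, θ'ᵀ = -θ' ∧ IsTuple θ' W := by
  choose t ht using hW
  -- The chosen `t j l` and `t l j` need not be opposite, so only the entries above the diagonal are
  -- kept.
  refine ⟨Matrix.of fun j l => if j < l then t j l else if l < j then -t l j else 0, ?_, ?_⟩
  · ext j l
    simp only [Matrix.transpose_apply, Matrix.neg_apply, Matrix.of_apply]
    rcases lt_trichotomy j l with h | rfl | h
    · simp [h, h.not_gt]
    · simp
    · simp [h, h.not_gt]
  · intro j l
    simp only [Matrix.of_apply]
    split_ifs with h1 h2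
    · exact ht j l
    · exact phase_comm_symm (ht l j)
    · obtain rfl : j = l := le_antisymm (not_lt.1 h2) (not_lt.1 h1)
      rw [phase_zero, one_smul]

/-- An ergodic algebra spanned by monomials in eigenunitaries is a quantum torus, equivariantly. -/
theorem exists_starAlgEquiv_torus [Nontrivial A] (he : IsErgodic β)
    {M : Matrix (Fin n) (Fin n) ℤ} (hM : M.det ≠ 0) {W : Fin n → unitary A}
    (hW : ∀ j, (W j : A) ∈ spec β ((realMatrix M)⁻¹ j))
    (hspan : (Submodule.span ℂ (Set.range fun z : Fin n → ℤ =>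
      ((monomial W z : unitary A) : A))).topologicalClosure = ⊤) :
    ∃ θ' : Matrix (Fin n) (Fin n) ℝ, θ'ᵀ = -θ' ∧ ∃ Φ : A ≃⋆ₐ[ℂ] Torus θ',
      ∀ s a, Φ (β (.ofAdd (realMatrix M *ᵥ s)) a) = Torus.gauge θ' (.ofAdd s) (Φ a) := by
  -- The products `W j * W l` and `W l * W j` lie in the same spectral line, so they differ by a
  -- phase.
  obtain ⟨θ', hθ', hT⟩ := exists_skew_isTuple (W := W) fun j l => by
    have h1 : ((W l * W j : unitary A) : A) ∈ spec β ((realMatrix M)⁻¹ j + (realMatrix M)⁻¹ l) := by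
      rw [add_comm]
      exact mul_mem_spec (hW l) (hW j)
    exact he.exists_phase_smul h1 (w := W j * W l) (mul_mem_spec (hW j) (hW l))
  let ψ := Torus.lift W hT
  have hψ (s : Fin n → ℝ) (x : Torus θ') :
      ψ (Torus.gauge θ' (.ofAdd s) x) = β (.ofAdd (realMatrix M *ᵥ s)) (ψ x) := by
    have h1 : ψ.comp (Torus.gaugeHom θ' s) =
        (β (.ofAdd (realMatrix M *ᵥ s)) : A →⋆ₐ[ℂ] A).comp ψ :=
      Torus.hom_ext fun k => by
        rw [StarAlgHom.comp_apply, StarAlgHom.comp_apply, Torus.gaugeHom_u, map_smul, Torus.lift_u]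
        have h2 := hW k (realMatrix M *ᵥ s)
        have h3 : (realMatrix M)⁻¹ k ⬝ᵥ realMatrix M *ᵥ s = s k := by
          change ((realMatrix M)⁻¹ *ᵥ (realMatrix M *ᵥ s)) k = s k
          rw [Matrix.mulVec_mulVec, Matrix.nonsing_inv_mul _ (isUnit_det_realMatrix hM),
            Matrix.one_mulVec]
        rw [h3] at h2
        exact h2.symm
    exact DFunLike.congr_fun h1 x
  have hinj : Function.Injective ψ :=
    Torus.injective_of_gauge_invariant_ker ψ fun s x hx => by rw [hψ, hx, map_zero]
  have hsurj : Function.Surjective ψ := fun a => by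
    have h1 : Submodule.span ℂ (Set.range fun z : Fin n → ℤ => ((monomial W z : unitary A) : A)) ≤
        LinearMap.range ψ.toAlgHom.toLinearMap := by
      rw [Submodule.span_le]
      rintro _ ⟨z, rfl⟩
      refine ⟨(monomial (Torus.u θ') z : unitary (Torus θ')), ?_⟩
      have h2 := map_monomial (unitaryMap ψ) (Torus.u θ') z
      have h3 : (fun j => unitaryMap ψ (Torus.u θ' j)) = W :=
        funext fun k => Subtype.ext (Torus.lift_u W hT k)
      rw [h3] at h2
      exact congrArg Subtype.val h2
    exact Submodule.topologicalClosure_minimal _ h1 (isClosed_range_of_injective hinj)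
      (hspan ▸ Submodule.mem_top : a ∈ _)
  let Ψ : Torus θ' ≃⋆ₐ[ℂ] A := StarAlgEquiv.ofBijective ψ ⟨hinj, hsurj⟩
  refine ⟨θ', hθ', Ψ.symm, fun s a => ?_⟩
  obtain ⟨x, rfl⟩ := EquivLike.surjective Ψ a
  refine EquivLike.injective Ψ ?_
  rw [StarAlgEquiv.apply_symm_apply, StarAlgEquiv.symm_apply_apply]
  exact (hψ s x).symm

variable {θ : Matrix (Fin n) (Fin n) ℝ} {ι : Torus θ →⋆ₐ[ℂ] A}

theorem IsGaugeLift.apply_u_mem_spec (hl : IsGaugeLift ι β) (k : Fin n) :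
    ι (Torus.u θ k : Torus θ) ∈ spec β (Pi.single k 1) := fun s => by
  rw [hl.extends_gauge, Torus.gauge_u, map_smul, single_dotProduct, one_mul]

/-- A parameter acting trivially on `A` acts trivially on the embedded torus, so it is integral; a
cocompact subgroup of `ℤⁿ` contains a multiple of `ℤⁿ`. -/
theorem IsGaugeLift.exists_period (hskew : θᵀ = -θ) (hι : Function.Injective ι)
    (hl : IsGaugeLift ι β) :
    ∃ N : ℕ, 0 < N ∧ ∀ m : Fin n → ℤ, β (.ofAdd ((N : ℝ) • fun i => (m i : ℝ))) = 1 := by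
  have := hl.compact
  refine exists_pos_forall_smul_mem β.ker fun s hs => (gauge_eq_one_iff hskew).1 ?_
  ext x
  apply hι
  rw [← hl.extends_gauge, MonoidHom.mem_ker.1 hs]
  rfl

/-- The model generators commute with phases from `M θ' Mᵀ` and from `θ`. Their products are
nonzero, so the phases agree and the exponents differ by integers. -/
theorem isModelData_of_isTuple {θ' : Matrix (Fin n) (Fin n) ℝ} {M : Matrix (Fin n) (Fin n) ℤ}
    (hM : M.det ≠ 0) (hθ' : θ'ᵀ = -θ') (h : IsTuple θ (modelGenerator M θ')) :
    IsModelData θ M θ' := by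
  refine ⟨hM, hθ', ?_⟩
  have := Torus.nontrivial hθ'
  have h1 (k l : Fin n) : ∃ m : ℤ, (realMatrix M * θ' * (realMatrix M)ᵀ) k l - θ k l = m := by
    rw [← phase_eq_phase_iff]
    have h2 := (modelGenerator_comm (M := M) (θ' := θ') k l).symm.trans (h k l)
    exact smul_left_injective ℂ
      (ne_zero_of_unitary (modelGenerator M θ' l * modelGenerator M θ' k)) h2
  choose m hm using h1
  refine ⟨Matrix.of m, ?_⟩
  ext k l
  rw [Matrix.add_apply, Matrix.map_apply, Matrix.of_apply, ← hm, add_sub_cancel]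

/-- An algebra with an ergodic lift of the gauge action of an embedded quantum torus is itself a
quantum torus, in which the generators of the embedded torus are monomials. -/
theorem IsGaugeLift.exists_model (hskew : θᵀ = -θ) (hι : Function.Injective ι)
    (hl : IsGaugeLift ι β) (he : IsErgodic β) :
    ∃ (M : Matrix (Fin n) (Fin n) ℤ) (θ' : Matrix (Fin n) (Fin n) ℝ), IsModelData θ M θ' ∧
      ∃ Φ : A ≃⋆ₐ[ℂ] Torus θ',
        (∀ s a, Φ (β (.ofAdd (realMatrix M *ᵥ s)) a) = Torus.gauge θ' (.ofAdd s) (Φ a)) ∧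
        ∀ k, Φ (ι (Torus.u θ k : Torus θ)) = modelGenerator M θ' k := by
  have := Torus.nontrivial hskew
  have : Nontrivial A := hι.nontrivial
  obtain ⟨N, hN, hper⟩ := hl.exists_period hskew hι
  obtain ⟨M, W, hM, hW, hspan⟩ := exists_eigenunitaries he hl.continuous hN hper
    (w := fun k => unitaryMap ι (Torus.u θ k)) hl.apply_u_mem_spec
  obtain ⟨θ', hθ', Φ, hΦ⟩ := exists_starAlgEquiv_torus he hM hW hspan
  have := Torus.nontrivial hθ'
  have hmem (k : Fin n) :
      Φ (ι (Torus.u θ k : Torus θ)) ∈ spec (Torus.gauge θ') (realMatrix M k) := fun s => by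
    rw [← hΦ, hl.apply_u_mem_spec, map_smul, single_dotProduct, one_mul]
    rfl
  choose r hr using fun k => Torus.isErgodic_gauge.exists_phase_smul
    (modelGenerator_mem_spec (M := M) (θ' := θ') k)
    (w := unitaryMap ((Φ : A →⋆ₐ[ℂ] Torus θ').comp ι) (Torus.u θ k)) (hmem k)
  -- Solving `M t = -r` yields a gauge transformation that removes all phases `r k` at once; it
  -- commutes with the gauge action, so equivariance survives.
  let t := -((realMatrix M)⁻¹ *ᵥ r)
  have hgen (k : Fin n) : Torus.gauge θ' (.ofAdd t) (Φ (ι (Torus.u θ k : Torus θ))) =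
      modelGenerator M θ' k := by
    have h1 : Φ (ι (Torus.u θ k : Torus θ)) = phase (r k) • (modelGenerator M θ' k : Torus θ') :=
      hr k
    have h2 : realMatrix M k ⬝ᵥ t = -r k := by
      change (realMatrix M *ᵥ t) k = -r k
      rw [Matrix.mulVec_neg, Matrix.mulVec_mulVec, Matrix.mul_nonsing_inv _
        (isUnit_det_realMatrix hM), Matrix.one_mulVec, Pi.neg_apply]
    rw [h1, map_smul, modelGenerator_mem_spec k t, h2, smul_smul, ← phase_add, add_neg_cancel,
      phase_zero, one_smul]
  refine ⟨M, θ', isModelData_of_isTuple hM hθ' fun k l => ?_, Φ.trans (Torus.gauge θ' (.ofAdd t)),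
    fun s a => ?_, hgen⟩
  · rw [← hgen, ← hgen, ← map_mul, ← map_mul, ← map_mul, Torus.isTuple_u, map_smul, map_smul,
      map_smul, ← map_mul, ← map_mul, ← map_mul]
  · rw [StarAlgEquiv.trans_apply, StarAlgEquiv.trans_apply, hΦ, action_comm]

end Structure

/-! ### Deck transformations of connected coverings -/

section Deck

variable {n : ℕ} {θ θ' : Matrix (Fin n) (Fin n) ℝ} {M : Matrix (Fin n) (Fin n) ℤ}
  {A : Type*} [CStarAlgebra A] {Φ : A ≃⋆ₐ[ℂ] Torus θ'}

/-- An automorphism commuting with the gauge action and fixing the generators of the embedded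
quantum torus is a deck transformation of the model. -/
theorem exists_deckAction_eq_of_commute {β : Multiplicative (Fin n → ℝ) →* (A ≃⋆ₐ[ℂ] A)}
    (hM : M.det ≠ 0) (hθ' : θ'ᵀ = -θ')
    (hΦ : ∀ s a, Φ (β (.ofAdd (realMatrix M *ᵥ s)) a) = Torus.gauge θ' (.ofAdd s) (Φ a))
    {τ : A ≃⋆ₐ[ℂ] A} (hτ : ∀ s a, τ (β s a) = β s (τ a))
    (hfix : ∀ k a, Φ a = modelGenerator M θ' k → τ a = a) :
    ∃ d : DeckGroup M, ∀ a, Φ (τ a) = deckAction M θ' d (Φ a) := by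
  have := Torus.nontrivial hθ'
  let T : Torus θ' →⋆ₐ[ℂ] Torus θ' :=
    ((Φ : A →⋆ₐ[ℂ] Torus θ').comp (τ : A →⋆ₐ[ℂ] A)).comp (Φ.symm : Torus θ' →⋆ₐ[ℂ] A)
  have hT (x : Torus θ') : T x = Φ (τ (Φ.symm x)) := rfl
  have hcomm (s : Fin n → ℝ) (x : Torus θ') :
      T (Torus.gauge θ' (.ofAdd s) x) = Torus.gauge θ' (.ofAdd s) (T x) := by
    rw [hT, hT, ← hΦ, ← hτ]
    congr 2
    refine EquivLike.injective Φ ?_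
    rw [StarAlgEquiv.apply_symm_apply, hΦ, StarAlgEquiv.apply_symm_apply]
  have hmem (j : Fin n) : T (Torus.u θ' j : Torus θ') ∈ spec (Torus.gauge θ') (Pi.single j 1) :=
    fun s => by rw [← hcomm, Torus.u_mem_spec j s, map_smul]
  -- Commuting with the gauge action, `T` preserves each spectral line and can only rotate `U j` by
  -- a phase.
  choose t ht using fun j => Torus.isErgodic_gauge.exists_phase_smul (Torus.u_mem_spec j)
    (w := unitaryMap T (Torus.u θ' j)) (hmem j)
  have hTt : T = Torus.gaugeHom θ' t :=
    Torus.hom_ext fun j => (ht j).trans (Torus.gaugeHom_u t j).symm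
  have hτt (a : A) : Φ (τ a) = Torus.gauge θ' (.ofAdd t) (Φ a) := by
    have h1 := DFunLike.congr_fun hTt (Φ a)
    rw [hT, StarAlgEquiv.symm_apply_apply] at h1
    exact h1
  -- Fixing the model generators makes each coordinate of `M t` an integer.
  have htM : t ∈ invLattice M := by
    rw [mem_invLattice hM, mem_intLattice]
    intro k
    have h1 := hτt (Φ.symm (modelGenerator M θ' k : Torus θ'))
    rw [hfix k _ (StarAlgEquiv.apply_symm_apply _ _), StarAlgEquiv.apply_symm_apply,
      modelGenerator_mem_spec k t, ← sub_eq_zero] at h1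
    have h2 : (1 - phase (realMatrix M k ⬝ᵥ t)) • (modelGenerator M θ' k : Torus θ') = 0 := by
      rw [sub_smul, one_smul, h1]
    rw [smul_eq_zero, or_iff_left (ne_zero_of_unitary _), sub_eq_zero] at h2
    exact (phase_eq_one_iff _).1 h2.symm
  exact ⟨.ofAdd (QuotientAddGroup.mk ⟨t, htM⟩), hτt⟩

/-- A finite group of deck transformations whose fixed points are fixed by all deck
transformations is the full deck group. -/
theorem surjective_of_forall_fixed {G : Type*} [Group G] [Finite G] (hθ' : θ'ᵀ = -θ')
    {φ : G →* DeckGroup M} (hφ : Function.Injective φ)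
    (hfix : ∀ x, (∀ g, deckAction M θ' (φ g) x = x) → ∀ d, deckAction M θ' d x = x) :
    Function.Surjective φ := by
  classical
  have := Torus.nontrivial hθ'
  have := Fintype.ofFinite G
  intro d
  by_contra! hd
  obtain ⟨χ, hχ, hsep⟩ := exists_separating_characters hθ' M
  -- If `d` is missed, the coset `d φ(G)` avoids `1`, so some Ellwood function is `1` at `1` and
  -- zero on the rest of `φ(G)` and on the whole coset.
  obtain ⟨z, hz1, hz0⟩ := exists_ellwoodMap_eq hχ hsep 1 1
    ((Finset.univ.image φ).erase 1 ∪ Finset.univ.image fun g => d * φ g) (by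
      simp only [Finset.mem_union, Finset.mem_erase, Finset.mem_image, Finset.mem_univ, true_and,
        not_or, ne_eq, not_true_eq_false, false_and, not_false_eq_true, not_exists]
      intro g hg
      exact hd g⁻¹ (by rw [map_inv]; exact (eq_inv_of_mul_eq_one_left hg).symm))
  -- The orbit sum of `y` over `φ(G)` is fixed by `φ(G)`, hence by `e`, so Ellwood functions have
  -- equal sums over `φ(G)` and its cosets. For `z` and `d` this reads `0 = 1`.
  have hsum (e : DeckGroup M) (w : Torus θ' ⊗[ℂ] Torus θ') :
      ∑ g, ellwoodMap (deckAction M θ') w (e * φ g) = ∑ g, ellwoodMap (deckAction M θ') w (φ g) := by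
    induction w using TensorProduct.induction_on with
    | zero => simp
    | add x y hx hy => simp only [map_add, Pi.add_apply, Finset.sum_add_distrib, hx, hy]
    | tmul x y =>
      have h1 := hfix (∑ g, deckAction M θ' (φ g) y) (fun h => by
        rw [map_sum]
        simp only [← StarAlgEquiv.mul_apply, ← map_mul]
        exact Fintype.sum_equiv (Equiv.mulLeft h) _ _ fun g => rfl) e
      rw [map_sum] at h1
      simp only [ellwoodMap_tmul, ← Finset.mul_sum, map_mul, StarAlgEquiv.mul_apply]
      rw [h1]
  have h1 := hsum d z
  rw [Finset.sum_eq_zero fun g _ => hz0 _ (Finset.mem_union_right _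
    (Finset.mem_image_of_mem _ (Finset.mem_univ g))), Finset.sum_eq_single 1, map_one, hz1] at h1
  · exact zero_ne_one h1
  · intro g _ hg
    refine hz0 _ (Finset.mem_union_left _ (Finset.mem_erase.2 ⟨?_,
      Finset.mem_image_of_mem _ (Finset.mem_univ g)⟩))
    rw [← map_one φ]
    exact hφ.ne hg
  · simp

theorem IsConnectedCovering.exists_isEquivalence {G : Type*} [Group G] [Finite G]
    {α : G →* (A ≃⋆ₐ[ℂ] A)} {ι : Torus θ →⋆ₐ[ℂ] A} (hskew : θᵀ = -θ) (hcov : IsCovering α ι)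
    (hconn : IsConnectedCovering α ι) :
    ∃ (M : Matrix (Fin n) (Fin n) ℤ) (θ' : Matrix (Fin n) (Fin n) ℝ), IsModelData θ M θ' ∧
      ∃ (Φ : A ≃⋆ₐ[ℂ] Torus θ') (φ : G ≃* DeckGroup M), IsEquivalence α (deckAction M θ') Φ φ ∧
        ∀ k, Φ (ι (Torus.u θ k : Torus θ)) = (modelGenerator M θ' k : Torus θ') := by
  have := Torus.nontrivial hskew
  have : Nontrivial A := hcov.injective.nontrivial
  obtain ⟨β, hl, he, hcomm⟩ := hconn
  obtain ⟨M, θ', hmod, Φ, hΦ, hgen⟩ := hl.exists_model hskew hcov.injective he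
  have hιfix (x : Torus θ) (g : G) : α g (ι x) = ι x :=
    (hcov.range_eq ▸ Set.mem_range_self x : ι x ∈ {a | ∀ g, α g a = a}) g
  choose d hd using fun g => exists_deckAction_eq_of_commute hmod.det_ne_zero hmod.skew hΦ
    (τ := α g) (hcomm g) fun k a ha => by
      rw [EquivLike.injective Φ (ha.trans (hgen k).symm), hιfix]
  have hd' (g : G) (x : Torus θ') : deckAction M θ' (d g) x = Φ (α g (Φ.symm x)) := by
    rw [hd, StarAlgEquiv.apply_symm_apply]
  -- Multiplicativity of `d` follows from faithfulness of the deck action.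
  let φ : G →* DeckGroup M := MonoidHom.mk' d fun g h => by
    apply deckAction_injective hmod.skew
    ext x
    rw [map_mul, StarAlgEquiv.mul_apply, hd', hd', hd', map_mul, StarAlgEquiv.mul_apply,
      StarAlgEquiv.symm_apply_apply]
  have hinj : Function.Injective φ := fun g h hgh => by
    apply hcov.free.injective
    ext a
    refine EquivLike.injective Φ ?_
    rw [hd, hd]
    exact congrArg (fun e => deckAction M θ' e (Φ a)) hgh
  have hhom : (Φ : A →⋆ₐ[ℂ] Torus θ').comp ι = modelHom hmod :=
    Torus.hom_ext fun k => (hgen k).trans (modelHom_u hmod k).symm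
  -- Elements fixed by `G` come from the embedded base torus, which every deck transformation fixes.
  have hsurj : Function.Surjective φ :=
    surjective_of_forall_fixed hmod.skew hinj fun x hx e => by
      have h1 : Φ.symm x ∈ Set.range ι := by
        rw [hcov.range_eq]
        intro g
        refine EquivLike.injective Φ ?_
        rw [StarAlgEquiv.apply_symm_apply]
        exact (hd' g x).symm.trans (hx g)
      obtain ⟨y, hy⟩ := h1
      have h2 : x = modelHom hmod y := by
        rw [← hhom, ← Φ.apply_symm_apply x, ← hy]
        rfl
      rw [h2, modelHom_mem_fixed]
  exact ⟨M, θ', hmod, Φ, MulEquiv.ofBijective φ ⟨hinj, hsurj⟩, hd, hgen⟩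

end Deck

end QuantumTorus
open QuantumTorus in
/-- Let `θ` be quite irrational and `(A, G, α)` a C⋆-dynamical system with `G` finite.
(1) `(A, G, α)` is a connected covering of the quantum torus of `θ` (for some identification of
its fixed point algebra with that torus) iff it is equivalent to a model
`(Torus θ', (M⁻¹ ℤⁿ) / ℤⁿ, γ')`.
(2) For each covering `(A, G, α)` with a given identification `ι` of the fixed point algebra, it is
connected iff it is equivalent to a model by an equivalence which maps the generators
of the quantum torus of `θ` to their canonical counterparts in the model. -/
theorem theorem4p5 {n : ℕ} (θ : Matrix (Fin n) (Fin n) ℝ) (hskew : θᵀ = -θ)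
    (hθ : QuiteIrrational θ) {A : Type*} [CStarAlgebra A] {G : Type*} [Group G] [Finite G]
    (α : G →* (A ≃⋆ₐ[ℂ] A)) :
    ((∃ ι : Torus θ →⋆ₐ[ℂ] A, IsCovering α ι ∧ IsConnectedCovering α ι) ↔
      ∃ (M : Matrix (Fin n) (Fin n) ℤ) (θ' : Matrix (Fin n) (Fin n) ℝ), IsModelData θ M θ' ∧
        ∃ (Φ : A ≃⋆ₐ[ℂ] Torus θ') (φ : G ≃* DeckGroup M),
          IsEquivalence α (deckAction M θ') Φ φ) ∧
    ∀ ι : Torus θ →⋆ₐ[ℂ] A, IsCovering α ι →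
      (IsConnectedCovering α ι ↔
        ∃ (M : Matrix (Fin n) (Fin n) ℤ) (θ' : Matrix (Fin n) (Fin n) ℝ), IsModelData θ M θ' ∧
          ∃ (Φ : A ≃⋆ₐ[ℂ] Torus θ') (φ : G ≃* DeckGroup M),
            IsEquivalence α (deckAction M θ') Φ φ ∧
            ∀ k, Φ (ι (Torus.u θ k : Torus θ)) = (modelGenerator M θ' k : Torus θ')) := by
  refine ⟨⟨?_, ?_⟩, fun ι hcov => ⟨fun hconn => hconn.exists_isEquivalence hskew hcov, ?_⟩⟩
  · rintro ⟨ι, hcov, hconn⟩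
    obtain ⟨M, θ', hmod, Φ, φ, heq, -⟩ := hconn.exists_isEquivalence hskew hcov
    exact ⟨M, θ', hmod, Φ, φ, heq⟩
  · rintro ⟨M, θ', hmod, Φ, φ, heq⟩
    refine ⟨_, isCovering_of_isEquivalence hmod heq,
      isConnectedCovering_of_isEquivalence hmod heq fun k => ?_⟩
    exact (Φ.apply_symm_apply _).trans (modelHom_u hmod k)
  · rintro ⟨M, θ', hmod, Φ, φ, heq, hgen⟩
    exact isConnectedCovering_of_isEquivalence hmod heq hgen
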